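/- Let $0<\alpha\le 1$, $\phi\in\mathbb R$, $s\in\{1,-1\}$, $M>0$, $k>0$, $m\in\mathbb Z$, and suppose that the effective angular momentum $$j=\frac{m+\phi}{\alpha}-\frac{(1-\alpha)s}{2\alpha}$$ satisfies $0<|j|<1$. Let $h_0=-\frac{d^2}{dr^2}-\frac1r\frac{d}{dr}+\frac{j^2}{r^2}$. For $-\infty<\nu\le\infty$ let $h_{0,\nu}$ be the extension of $h_0$ in $L^2((0,\infty),r\,dr)$ whose domain consists of the $\psi\in L^2$ with $\psi,\psi'$ locally absolutely continuous on $(0,\infty)$ and $h_0\psi\in L^2$ that satisfy the boundary condition $\nu\psi_{0,j}=\psi_{1,j}$ (which means $\psi_{0,j}=0$ if $\nu=\infty$), where $$\psi_{0,j}=\lim_{r\to0^+}r^{|j|}\psi(r),\qquad \psi_{1,j}=\lim_{r\to0^+}r^{-|j|}\bigl[\psi(r)-\psi_{0,j}r^{-|j|}\bigr].$$ A generalized eigenfunction at momentum $k$ is a nonzero $\psi$, with $\psi,\psi'$ locally absolutely continuous on $(0,\infty)$, that satisfies $h_0\psi=k^2\psi$ and this boundary condition, without being required to be square integrable. A number $\delta\in\mathbb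 R$ is a phase shift in the channel $m$ if some generalized eigenfunction satisfies $\sqrt r\,\psi(r)-C\cos(kr-\frac{|m|\pi}{2}-\frac\pi4+\delta)\to0$ as $r\to\infty$ for some $C\in\mathbb C\setminus\{0\}$. With $\theta(r)=kr-\frac{|m|\pi}{2}-\frac\pi4$, a number $S\in\mathbb C$ is an S-matrix element in this channel if some generalized eigenfunction satisfies $\sqrt r\,\psi(r)-C(e^{-i\theta(r)}+S\,e^{i\theta(r)})\to0$ as $r\to\infty$ for some $C\in\mathbb C\setminus\{0\}$. Put $\mu_\infty=0$, $\delta_m=\frac\pi2(|m|-|j|)$ and, for finite $\nu$, $$\mu_\nu=\frac{k^{2|j|}\,\Gamma(1-|j|)\sin(|j|\pi)}{4^{|j|}\,\Gamma(1+|j|)\,\nu+k^{2|j|}\,\Gamma(1-|j|)\cos(|j|\pi)}.$$ Let $Y_p=\dfrac{J_p\cos(p\pi)-J_{-p}}{\sin(p\pi)}$ be the Bessel function of the second kind. Then the following hold. 1. If $\nu=\infty$, or if $\nu$ is finite and the denominator of $\mu_\nu$ is nonzero, then the generalized eigenfunctions of $h_{0,\nu}$ at momentum $k$ are exactly the nonzero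 complex multiples of $$J_{|j|}(kr)-\mu_\nu\,Y_{|j|}(kr).$$ The phase shifts are, modulo $\pi$, exactly $\delta_m^\nu=\delta_m+\arctan\mu_\nu$, and there is exactly one S-matrix element, namely $$S_m^\nu=e^{2i\delta_m^\nu}=e^{2i\delta_m}\,\frac{1+i\mu_\nu}{1-i\mu_\nu}.$$ 2. If $\nu$ is finite and $\nu<0$, then there is exactly one bound-state energy, that is, exactly one $E_b\in\mathbb R$ for which $2ME_b$ is an eigenvalue of $h_{0,\nu}$, namely $$E_b=-\frac2M\Bigl[-\nu\,\frac{\Gamma(1+|j|)}{\Gamma(1-|j|)}\Bigr]^{1/|j|}.$$ With the bound-state momentum $\kappa_b=\sqrt{2ME_b}$ (principal roots and powers, so that $\kappa_b\in i(0,\infty)$), for every $k>0$ the unique S-matrix element is $$S_m^\nu=e^{2i\delta_m}\,\frac{e^{2i\pi|j|}-(\kappa_b/k)^{2|j|}}{1-(\kappa_b/k)^{2|j|}},$$ and the denominator does not vanish. 3. If $\nu=\infty$, then the generalized eigenfunctions are exactly the nonzero multiples of $J_{|j|}(kr)$, and the S-matrix element is the Aharonov–Bohm one on the cone, $e^{2i\delta_m}=e^{i\pi(|m|-|j|)}$.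 -/

import Mathlib

open Filter Topology MeasureTheory

noncomputable section

namespace ConicalAB

/-- Effective angular momentum `j = (m + φ)/α - (1 - α) s/(2α)` of the channel `m`. -/
def effectiveJ (α φ s : ℝ) (m : ℤ) : ℝ :=
  ((m : ℝ) + φ) / α - (1 - α) * s / (2 * α)

/-- Bessel function of the first kind of real order `p`, for `x > 0`, by its power series
(`Real.Gamma` vanishes at its poles, so that `1 / Γ = 0` there, as it should). -/
def besselJ (p x : ℝ) : ℝ :=
  ∑' n : ℕ, (-1 : ℝ) ^ n / ((n.factorial : ℝ) * Real.Gamma ((n : ℝ) + p + 1)) *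
    (x / 2) ^ (2 * (n : ℝ) + p)

/-- Bessel function of the second kind (Neumann function) of non-integer real order `p`. -/
def besselY (p x : ℝ) : ℝ :=
  (besselJ p x * Real.cos (p * Real.pi) - besselJ (-p) x) / Real.sin (p * Real.pi)

/-- The radial differential expression `h₀ ψ = -ψ'' - ψ'/r + (j²/r²) ψ`. -/
def radialH (j : ℝ) (ψ : ℝ → ℂ) (r : ℝ) : ℂ :=
  -deriv (deriv ψ) r - (1 / (r : ℂ)) * deriv ψ r + ((j : ℂ) ^ 2 / (r : ℂ) ^ 2) * ψ r

/-- The measure `r dr` on the half-line `(0, ∞)`. -/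
def radialMeasure : Measure ℝ :=
  (volume.restrict (Set.Ioi 0)).withDensity (fun r => ENNReal.ofReal r)

/-- `ψ` and `ψ'` are locally absolutely continuous on `(0, ∞)`
(`ψ` itself is then continuously differentiable). -/
def LocallyRegular (ψ : ℝ → ℂ) : Prop :=
  (∀ r : ℝ, 0 < r → DifferentiableAt ℝ ψ r) ∧
    ∀ a b : ℝ, 0 < a → a < b → AbsolutelyContinuousOnInterval (deriv ψ) a b

/-- The boundary values at the origin exist and are `c₀ = lim r^{|j|} ψ(r)` and
`c₁ = lim r^{-|j|} (ψ(r) - c₀ r^{-|j|})`, as `r → 0⁺`. -/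
def HasBoundaryValues (j : ℝ) (ψ : ℝ → ℂ) (c₀ c₁ : ℂ) : Prop :=
  Tendsto (fun r : ℝ => ((r ^ |j| : ℝ) : ℂ) * ψ r) (𝓝[>] 0) (𝓝 c₀) ∧
  Tendsto (fun r : ℝ => ((1 / r ^ |j| : ℝ) : ℂ) * (ψ r - c₀ * ((1 / r ^ |j| : ℝ) : ℂ)))
    (𝓝[>] 0) (𝓝 c₁)

/-- The boundary condition `ν ψ_{0,j} = ψ_{1,j}` with `-∞ < ν ≤ ∞`; for `ν = ∞` it
reads `ψ_{0,j} = 0`. -/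
def BoundaryCondition (j : ℝ) (ν : WithTop ℝ) (ψ : ℝ → ℂ) : Prop :=
  ∃ c₀ c₁ : ℂ, HasBoundaryValues j ψ c₀ c₁ ∧
    (ν = ⊤ → c₀ = 0) ∧ ∀ v : ℝ, ν = (v : WithTop ℝ) → (v : ℂ) * c₀ = c₁

/-- The domain of the self-adjoint operator `h_{0,ν}` in `L²((0, ∞), r dr)`. -/
def MemDomain (j : ℝ) (ν : WithTop ℝ) (ψ : ℝ → ℂ) : Prop :=
  LocallyRegular ψ ∧ MemLp ψ 2 radialMeasure ∧ MemLp (radialH j ψ) 2 radialMeasure ∧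
    BoundaryCondition j ν ψ

/-- Generalized eigenfunctions of `h_{0,ν}` with eigenvalue `k²`: nonzero solutions of
`h₀ ψ = k² ψ` on `(0, ∞)` which lie locally in the domain of `h_{0,ν}`, that is, satisfy its
regularity requirements and its boundary condition, but need not be square integrable. -/
def IsGeneralizedEigenfunction (j : ℝ) (ν : WithTop ℝ) (k : ℝ) (ψ : ℝ → ℂ) : Prop :=
  LocallyRegular ψ ∧ BoundaryCondition j ν ψ ∧
    (∀ᵐ r ∂volume.restrict (Set.Ioi (0 : ℝ)), radialH j ψ r = ((k ^ 2 : ℝ) : ℂ) * ψ r) ∧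
    ∃ r : ℝ, 0 < r ∧ ψ r ≠ 0

/-- `E` is a bound-state energy: `2ME` is an eigenvalue of `h_{0,ν}`. -/
def IsBoundStateEnergy (j : ℝ) (ν : WithTop ℝ) (M E : ℝ) : Prop :=
  ∃ ψ : ℝ → ℂ, MemDomain j ν ψ ∧
    (∀ᵐ r ∂volume.restrict (Set.Ioi (0 : ℝ)), radialH j ψ r = ((2 * M * E : ℝ) : ℂ) * ψ r) ∧
    ∃ r : ℝ, 0 < r ∧ ψ r ≠ 0

/-- The phase `kr - |m|π/2 - π/4` of the free partial wave of angular momentum `m`. -/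
def freePhase (m : ℤ) (k r : ℝ) : ℝ :=
  k * r - |(m : ℝ)| * Real.pi / 2 - Real.pi / 4

/-- `δ` is a scattering phase shift of `h_{0,ν}` in the channel `m` at momentum `k`: some
generalized eigenfunction behaves as `C r^{-1/2} cos(kr - |m|π/2 - π/4 + δ)`, with `C ≠ 0`,
up to `o(r^{-1/2})` as `r → ∞`. -/
def IsPhaseShift (j : ℝ) (ν : WithTop ℝ) (m : ℤ) (k δ : ℝ) : Prop :=
  ∃ ψ : ℝ → ℂ, IsGeneralizedEigenfunction j ν k ψ ∧ ∃ C : ℂ, C ≠ 0 ∧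
    Tendsto (fun r : ℝ => ((√r : ℝ) : ℂ) * ψ r - C * ((Real.cos (freePhase m k r + δ) : ℝ) : ℂ))
      atTop (𝓝 0)

/-- `S` is the S-matrix element of `h_{0,ν}` in the channel `m` at momentum `k`: the amplitude
of the outgoing wave of a generalized eigenfunction relative to its incoming wave, normalized
by the free partial wave, for which it is `1`. -/
def IsSMatrixElement (j : ℝ) (ν : WithTop ℝ) (m : ℤ) (k : ℝ) (S : ℂ) : Prop :=
  ∃ ψ : ℝ → ℂ, IsGeneralizedEigenfunction j ν k ψ ∧ ∃ C : ℂ, C ≠ 0 ∧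
    Tendsto (fun r : ℝ => ((√r : ℝ) : ℂ) * ψ r -
        C * (Complex.exp (-(Complex.I * (freePhase m k r : ℂ))) +
          S * Complex.exp (Complex.I * (freePhase m k r : ℂ))))
      atTop (𝓝 0)

/-- The denominator of `μ_ν`, for finite `ν = v`. -/
def muDenom (j k v : ℝ) : ℝ :=
  4 ^ |j| * Real.Gamma (1 + |j|) * v +
    k ^ (2 * |j|) * Real.Gamma (1 - |j|) * Real.cos (|j| * Real.pi)

/-- The coefficient `μ_ν`, with `μ_∞ = 0`. -/
def mu (j k : ℝ) : WithTop ℝ → ℝ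
  | ⊤ => 0
  | (v : ℝ) =>
      k ^ (2 * |j|) * Real.Gamma (1 - |j|) * Real.sin (|j| * Real.pi) / muDenom j k v

/-- Aharonov–Bohm phase shift on the cone, `δ_m = (π/2)(|m| - |j|)`. -/
def phaseShiftAB (j : ℝ) (m : ℤ) : ℝ :=
  Real.pi / 2 * (|(m : ℝ)| - |j|)

/-- The phase shift `δ_m^ν = δ_m + arctan μ_ν`. -/
def phaseShift (j : ℝ) (ν : WithTop ℝ) (m : ℤ) (k : ℝ) : ℝ :=
  phaseShiftAB j m + Real.arctan (mu j k ν)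

/-- Aharonov–Bohm S-matrix element on the cone, `e^{2iδ_m}`. -/
def sMatrixAB (j : ℝ) (m : ℤ) : ℂ :=
  Complex.exp (2 * Complex.I * (phaseShiftAB j m : ℂ))

/-- The bound-state energy `-(2/M) [-v Γ(1+|j|)/Γ(1-|j|)]^{1/|j|}`, for `v < 0`. -/
def boundEnergy (j M v : ℝ) : ℝ :=
  -(2 / M) * (-v * Real.Gamma (1 + |j|) / Real.Gamma (1 - |j|)) ^ (1 / |j|)

/-- The bound-state momentum `√(2ME)` (principal root, on the positive imaginary axis if
`E < 0`). -/
def boundMomentum (M E : ℝ) : ℂ :=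
  ((2 * M * E : ℝ) : ℂ) ^ (1 / 2 : ℂ)

end ConicalAB

end

/-!
All radial solutions are treated at once, for a real spectral parameter: `u'' + u'/r - p²/r² u =
lam u` with `p = |j|`, where `lam = -k²` for scattering and `lam = κ²` for bound states.

For `0 < p < 1` the Frobenius solutions `frobenius (±p) lam`, which are `r^{±p}` times an entire
function of `lam r²`, span the solution space because their Wronskian is `-2p/r`
(`IsRadialSolution.exists_frobenius`), and in `a Φ_p + b Φ_{-p}` the boundary values are `c₀ = b`
and `c₁ = a` (`hasBoundaryValues_frobenius`). Hence, once a weak solution is known to be a classical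
one, the solutions with the boundary condition `ν` are the multiples of a single function
`boundarySolution` (`solution_iff`), which for `lam = -k²` is proportional to
`J_p(kr) - μ_ν Y_p(kr)` (`exists_bessel_eq`).

Everything at infinity comes from one fact, `hasDecay_frobenius`: for every `c ≠ 0` with `c² = lam`
and `Re c ≥ 0`,
`Φ_{-p} - ρ c^{2p} Φ_p ~ A e^{-cx}/√x` with `ρ = 4^{-p} Γ(1-p)/Γ(1+p)`.
The left side is, up to a factor, `x^p e^{-cx} ∫ e^{-xs} (s² + 2cs)^{p-1/2} ds`, whose behaviour at
infinity and leading term at the origin follow by dominated convergence. Its second coefficient is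
found without contour integrals: `u ↦ u' + (p/r) u` carries the order `p` to `1 - p`, and a
solution is determined by its decay at infinity (`IsRadialSolution.eq_of_hasDecay`), so that the
coefficient is the leading term at the origin for the order `1 - p`; the duplication formula for the
Gamma function puts it into the form above.

With `c = ∓ik` this gives the outgoing and the incoming wave, and the S-matrix element is
`e^{2iδ_m}` times the quotient of the coefficients, `(c₁ + ρ k^{2p} c₀ e^{iπp}) /
(c₁ + ρ k^{2p} c₀ e^{-iπp})` (`isSMatrixElement_iff`). With `c = κ > 0` it gives the square
integrable solution, which satisfies the boundary condition exactly if `ν = -ρ κ^{2p}`. There are no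
other bound states for `ν < 0` (`memLp_boundarySolution_iff`): for `lam ≥ 0` every other solution
with this boundary condition stays away from `0` at infinity, and for `lam = -k²` the waves have a
local mean square of order `1/r`, which is not integrable against `r dr`.
-/

namespace ConicalAB

/-! ### The entire series behind the Bessel functions -/

/-- The entire function `w ↦ ∑ wⁿ / (n! Γ(n + σ + 1))`, so that
`J_σ(x) = (x/2)^σ besselEntire σ (-x²/4)` and `I_σ(x) = (x/2)^σ besselEntire σ (x²/4)`. -/
noncomputable def besselEntire (σ w : ℝ) : ℝ :=
  ∑' n : ℕ, w ^ n / ((n.factorial : ℝ) * Real.Gamma ((n : ℝ) + σ + 1))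

lemma eventually_one_le_Gamma (σ : ℝ) : ∀ᶠ n : ℕ in atTop, 1 ≤ Real.Gamma ((n : ℝ) + σ + 1) := by
  obtain ⟨N, hN⟩ := exists_nat_ge (1 - σ)
  filter_upwards [eventually_ge_atTop N] with n hn
  have h : (2 : ℝ) ≤ (n : ℝ) + σ + 1 := by
    have : (N : ℝ) ≤ n := by exact_mod_cast hn
    linarith
  calc (1 : ℝ) = Real.Gamma 2 := Real.Gamma_two.symm
    _ ≤ _ := Real.Gamma_strictMonoOn_Ici.monotoneOn (Set.mem_Ici.2 le_rfl) h h

lemma summable_besselEntire (σ w : ℝ) :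
    Summable fun n : ℕ => w ^ n / ((n.factorial : ℝ) * Real.Gamma ((n : ℝ) + σ + 1)) := by
  refine Summable.of_norm_bounded_eventually_nat (g := fun n : ℕ => |w| ^ n / n.factorial)
    (Real.summable_pow_div_factorial _) ?_
  filter_upwards [eventually_one_le_Gamma σ] with n hn
  rw [norm_div, norm_pow, norm_mul, Real.norm_eq_abs, Real.norm_natCast,
    Real.norm_of_nonneg (zero_le_one.trans hn)]
  have := Nat.factorial_pos n
  gcongr
  exact le_mul_of_one_le_right (by positivity) hn

lemma hasDerivAt_besselEntire (σ w : ℝ) :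
    HasDerivAt (besselEntire σ) (besselEntire (σ + 1) w) w := by
  set M := |w| + 1 with hM
  have hterm : ∀ n : ℕ, ∀ y : ℝ,
      ((n + 1 : ℕ) : ℝ) * y ^ n / (((n + 1).factorial : ℝ) * Real.Gamma (((n + 1 : ℕ) : ℝ) + σ + 1))
        = y ^ n / ((n.factorial : ℝ) * Real.Gamma ((n : ℝ) + (σ + 1) + 1)) := by
    intro n y
    have h1 : (((n + 1 : ℕ) : ℝ) + σ + 1) = (n : ℝ) + (σ + 1) + 1 := by push_cast; ring
    rw [h1, Nat.factorial_succ, Nat.cast_mul, mul_assoc,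
      mul_div_mul_left _ _ (Nat.cast_ne_zero.2 (Nat.succ_ne_zero n))]
  have key := hasDerivAt_tsum_of_isPreconnected
    (g := fun (n : ℕ) (y : ℝ) => y ^ n / ((n.factorial : ℝ) * Real.Gamma ((n : ℝ) + σ + 1)))
    (g' := fun (n : ℕ) (y : ℝ) =>
      (n : ℝ) * y ^ (n - 1) / ((n.factorial : ℝ) * Real.Gamma ((n : ℝ) + σ + 1)))
    (u := fun n : ℕ => ‖(n : ℝ) * M ^ (n - 1) /
      ((n.factorial : ℝ) * Real.Gamma ((n : ℝ) + σ + 1))‖)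
    (t := Metric.ball 0 M) (y₀ := w) (y := w) ?_ Metric.isOpen_ball
    (convex_ball 0 M).isPreconnected ?_ ?_ ?_ (summable_besselEntire σ w) ?_
  · convert! key using 1
    have hs : Summable fun n : ℕ =>
        (n : ℝ) * w ^ (n - 1) / ((n.factorial : ℝ) * Real.Gamma ((n : ℝ) + σ + 1)) := by
      rw [← summable_nat_add_iff 1]
      simpa only [Nat.add_sub_cancel, hterm] using summable_besselEntire (σ + 1) w
    rw [hs.tsum_eq_zero_add, besselEntire]
    simp only [Nat.cast_zero, zero_mul, zero_div, zero_add, Nat.add_sub_cancel]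
    exact tsum_congr fun n => (hterm n w).symm
  · rw [← summable_nat_add_iff 1]
    simpa only [Nat.add_sub_cancel, hterm] using (summable_besselEntire (σ + 1) M).norm
  · intro n y _
    exact (hasDerivAt_pow n y).div_const _
  · intro n y hy
    rw [norm_div, norm_div]
    gcongr
    rw [norm_mul, norm_mul, norm_pow, norm_pow]
    gcongr
    have h1 : ‖y‖ < M := by simpa using hy
    exact h1.le.trans (le_abs_self _)
  · simp [hM]
  · simp [hM]

lemma continuous_besselEntire (σ : ℝ) : Continuous (besselEntire σ) :=
  continuous_iff_continuousAt.2 fun w => (hasDerivAt_besselEntire σ w).continuousAt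

lemma besselEntire_zero (σ : ℝ) : besselEntire σ 0 = 1 / Real.Gamma (1 + σ) := by
  rw [besselEntire, tsum_eq_single 0]
  · simp [add_comm]
  · intro n hn
    simp [hn]

/-- The contiguous relation `(σ + 1) R_{σ+1} + w R_{σ+2} = R_σ`. -/
lemma besselEntire_contiguous {σ : ℝ} (hσ : ∀ n : ℕ, (n : ℝ) + σ + 1 ≠ 0) (w : ℝ) :
    (σ + 1) * besselEntire (σ + 1) w + w * besselEntire (σ + 2) w = besselEntire σ w := by
  have h0 := (summable_besselEntire σ w).tsum_eq_zero_add
  have h1 := (summable_besselEntire (σ + 1) w).tsum_eq_zero_add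
  have e : besselEntire (σ + 2) w * w = ∑' n : ℕ, w ^ n /
      ((n.factorial : ℝ) * Real.Gamma ((n : ℝ) + (σ + 2) + 1)) * w := tsum_mul_right.symm
  have s1 := (summable_nat_add_iff 1).2 (summable_besselEntire (σ + 1) w)
  have s2 := (summable_besselEntire (σ + 2) w).mul_right w
  have hs := ((s1.mul_left (σ + 1)).tsum_add s2)
  rw [mul_comm w, e, besselEntire, h1, mul_add, add_assoc, ← tsum_mul_left, ← hs, besselEntire, h0]
  congr 1
  · have := Real.Gamma_add_one (s := σ + 1) (by simpa using hσ 0)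
    have h2 : σ + 1 ≠ 0 := by simpa using hσ 0
    simp only [pow_zero, Nat.factorial_zero, Nat.cast_one, one_mul, Nat.cast_zero, zero_add]
    rw [this]
    field_simp
  · refine tsum_congr fun n => ?_
    have h2 : (n : ℝ) + 1 + σ + 1 ≠ 0 := by simpa using hσ (n + 1)
    have h3 := Real.Gamma_add_one h2
    have e1 : ((n + 1 : ℕ) : ℝ) + (σ + 1) + 1 = (n : ℝ) + 1 + σ + 1 + 1 := by push_cast; ring
    have e2 : (n : ℝ) + (σ + 2) + 1 = (n : ℝ) + 1 + σ + 1 + 1 := by ring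
    have e3 : ((n + 1 : ℕ) : ℝ) + σ + 1 = (n : ℝ) + 1 + σ + 1 := by push_cast; ring
    rw [e1, e2, e3, h3, Nat.factorial_succ]
    by_cases hG : Real.Gamma ((n : ℝ) + 1 + σ + 1) = 0
    · simp [hG]
    have : (n.factorial : ℝ) ≠ 0 := by positivity
    have : (n : ℝ) + 1 ≠ 0 := by positivity
    push_cast
    field_simp
    ring

lemma besselJ_eq (p : ℝ) {x : ℝ} (hx : 0 < x) :
    besselJ p x = (x / 2) ^ p * besselEntire p (-(x ^ 2 / 4)) := by
  rw [besselJ, besselEntire, ← tsum_mul_left]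
  refine tsum_congr fun n => ?_
  have h : (x / 2) ^ (2 * (n : ℝ) + p) = (x ^ 2 / 4) ^ n * (x / 2) ^ p := by
    rw [Real.rpow_add (by positivity), show 2 * (n : ℝ) = ((2 * n : ℕ) : ℝ) by push_cast; ring,
      Real.rpow_natCast, pow_mul]
    congr 2
    ring
  rw [h, show -(x ^ 2 / 4) = -1 * (x ^ 2 / 4) by ring, mul_pow]
  ring

/-! ### The two Frobenius solutions -/

/-- The Frobenius solution `r^σ (1 + O(r²))` of `u'' + u'/r - σ²/r² u = lam u`, for `σ` not a
negative integer. -/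
noncomputable def frobenius (σ lam r : ℝ) : ℝ :=
  Real.Gamma (1 + σ) * r ^ σ * besselEntire σ (lam * r ^ 2 / 4)

/-- The derivative of `frobenius`. -/
noncomputable def frobeniusDeriv (σ lam r : ℝ) : ℝ :=
  Real.Gamma (1 + σ) * r ^ σ * (σ / r * besselEntire σ (lam * r ^ 2 / 4) +
    lam * r / 2 * besselEntire (σ + 1) (lam * r ^ 2 / 4))

/-- `u` is twice differentiable on `(0, ∞)` with derivative `u'`, and solves the radial equation
`u'' + u'/r - p²/r² u = lam u` there. -/
def IsRadialSolution (p lam : ℝ) (u u' : ℝ → ℂ) : Prop :=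
  ∀ r : ℝ, 0 < r → HasDerivAt u (u' r) r ∧
    HasDerivAt u' (-(1 / (r : ℂ)) * u' r + ((p : ℂ) ^ 2 / (r : ℂ) ^ 2 + lam) * u r) r

lemma hasDerivAt_besselEntire_comp (σ lam r : ℝ) :
    HasDerivAt (fun r : ℝ => besselEntire σ (lam * r ^ 2 / 4))
      (lam * r / 2 * besselEntire (σ + 1) (lam * r ^ 2 / 4)) r := by
  have h : HasDerivAt (fun r : ℝ => lam * r ^ 2 / 4) (lam * r / 2) r := by
    convert! ((hasDerivAt_pow 2 r).const_mul lam).div_const 4 using 1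
    push_cast; ring
  convert! (hasDerivAt_besselEntire σ (lam * r ^ 2 / 4)).comp r h using 1
  ring

lemma hasDerivAt_rpow_div {σ r : ℝ} (hr : 0 < r) :
    HasDerivAt (fun r : ℝ => r ^ σ) (σ / r * r ^ σ) r := by
  convert! Real.hasDerivAt_rpow_const (p := σ) (Or.inl hr.ne') using 1
  rw [Real.rpow_sub_one hr.ne']
  ring

lemma hasDerivAt_frobenius (σ lam : ℝ) {r : ℝ} (hr : 0 < r) :
    HasDerivAt (frobenius σ lam) (frobeniusDeriv σ lam r) r := by
  convert! (((hasDerivAt_rpow_div (σ := σ) hr).const_mul (Real.Gamma (1 + σ))).mul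
    (hasDerivAt_besselEntire_comp σ lam r)) using 1
  rw [frobeniusDeriv]
  ring

lemma hasDerivAt_frobeniusDeriv {σ : ℝ} (hσ : ∀ n : ℕ, (n : ℝ) + σ + 1 ≠ 0) (lam : ℝ) {r : ℝ}
    (hr : 0 < r) :
    HasDerivAt (frobeniusDeriv σ lam)
      (-(1 / r) * frobeniusDeriv σ lam r + (σ ^ 2 / r ^ 2 + lam) * frobenius σ lam r) r := by
  have h1 : HasDerivAt (fun r : ℝ => σ / r) (-σ / r ^ 2) r := by
    simpa [div_eq_mul_inv] using (hasDerivAt_inv hr.ne').const_mul σ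
  have h2 : HasDerivAt (fun r : ℝ => lam * r / 2) (lam / 2) r := by
    simpa using ((hasDerivAt_id r).const_mul lam).div_const 2
  convert! (((hasDerivAt_rpow_div (σ := σ) hr).const_mul (Real.Gamma (1 + σ))).mul
    ((h1.mul (hasDerivAt_besselEntire_comp σ lam r)).add
      (h2.mul (hasDerivAt_besselEntire_comp (σ + 1) lam r)))) using 1
  have h3 := besselEntire_contiguous hσ (lam * r ^ 2 / 4)
  rw [show σ + 1 + 1 = σ + 2 by ring]
  simp only [frobeniusDeriv, frobenius, Pi.mul_apply, Pi.add_apply]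
  rw [← h3]
  field_simp
  ring

lemma isRadialSolution_frobenius {σ p : ℝ} (hσ : ∀ n : ℕ, (n : ℝ) + σ + 1 ≠ 0)
    (hp : σ ^ 2 = p ^ 2) (lam : ℝ) :
    IsRadialSolution p lam (fun r => (frobenius σ lam r : ℂ))
      fun r => (frobeniusDeriv σ lam r : ℂ) := by
  intro r hr
  refine ⟨(hasDerivAt_frobenius σ lam hr).ofReal_comp, ?_⟩
  convert! (hasDerivAt_frobeniusDeriv hσ lam hr).ofReal_comp using 1
  rw [hp]
  push_cast
  rfl

lemma index_ne_of_gt {σ : ℝ} (hσ : -1 < σ) (n : ℕ) : (n : ℝ) + σ + 1 ≠ 0 := by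
  have : (0 : ℝ) ≤ n := n.cast_nonneg
  linarith

lemma tendsto_lam_sq (lam : ℝ) : Tendsto (fun r : ℝ => lam * r ^ 2 / 4) (𝓝[>] 0) (𝓝 0) := by
  have : Continuous fun r : ℝ => lam * r ^ 2 / 4 := by fun_prop
  simpa using (this.tendsto 0).mono_left nhdsWithin_le_nhds

lemma tendsto_Gamma_mul_besselEntire {σ : ℝ} (hσ : -1 < σ) (lam : ℝ) :
    Tendsto (fun r : ℝ => Real.Gamma (1 + σ) * besselEntire σ (lam * r ^ 2 / 4)) (𝓝[>] 0)
      (𝓝 1) := by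
  have h := (((continuous_besselEntire σ).tendsto 0).comp (tendsto_lam_sq lam)).const_mul
    (Real.Gamma (1 + σ))
  rw [besselEntire_zero, mul_one_div_cancel (Real.Gamma_pos_of_pos (by linarith)).ne'] at h
  exact h

lemma IsRadialSolution.linearCombination {p lam : ℝ} {u u' v v' : ℝ → ℂ}
    (hu : IsRadialSolution p lam u u') (hv : IsRadialSolution p lam v v') (a b : ℂ) :
    IsRadialSolution p lam (fun r => a * u r + b * v r) fun r => a * u' r + b * v' r := by
  intro r hr
  refine ⟨((hu r hr).1.const_mul a).add ((hv r hr).1.const_mul b), ?_⟩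
  convert! ((hu r hr).2.const_mul a).add ((hv r hr).2.const_mul b) using 1
  ring

/-- `r (u v' - u' v)` is constant for two solutions of the same radial equation. -/
lemma IsRadialSolution.wronskian_const {p lam : ℝ} {u u' v v' : ℝ → ℂ}
    (hu : IsRadialSolution p lam u u') (hv : IsRadialSolution p lam v v') :
    ∃ W : ℂ, ∀ r : ℝ, 0 < r → (r : ℂ) * (u r * v' r - u' r * v r) = W := by
  have hd : ∀ r ∈ Set.Ioi (0 : ℝ),
      HasDerivAt (fun r : ℝ => (r : ℂ) * (u r * v' r - u' r * v r)) 0 r := by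
    intro r hr
    have hr' : (r : ℂ) ≠ 0 := Complex.ofReal_ne_zero.2 (ne_of_gt hr)
    convert! (hasDerivAt_id r).ofReal_comp.mul
      (((hu r hr).1.mul (hv r hr).2).sub ((hu r hr).2.mul (hv r hr).1)) using 1
    simp only [id, Pi.sub_apply, Pi.mul_apply]
    field_simp
    push_cast
    ring
  refine ⟨((1 : ℝ) : ℂ) * (u 1 * v' 1 - u' 1 * v 1), fun r hr => ?_⟩
  exact isOpen_Ioi.is_const_of_deriv_eq_zero isPreconnected_Ioi
    (fun r hr => (hd r hr).differentiableAt.differentiableWithinAt)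
    (fun r hr => (hd r hr).deriv) hr (Set.mem_Ioi.2 one_pos)

lemma wronskian_frobenius {p : ℝ} (hp0 : 0 < p) (hp1 : p < 1) (lam : ℝ) {r : ℝ} (hr : 0 < r) :
    (r : ℂ) * ((frobenius p lam r : ℂ) * (frobeniusDeriv (-p) lam r : ℂ) -
      (frobeniusDeriv p lam r : ℂ) * (frobenius (-p) lam r : ℂ)) = -2 * p := by
  have s1 := isRadialSolution_frobenius (index_ne_of_gt (by linarith : -1 < p)) rfl lam
  have s2 := isRadialSolution_frobenius (index_ne_of_gt (by linarith : -1 < -p)) (neg_sq p) lam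
  obtain ⟨W, hW⟩ := s1.wronskian_const s2
  rw [hW r hr]
  -- near the origin `r Φ_σ' = r^σ (σ A_σ + o(1))` with `A_σ → 1`
  have lim0 : ∀ σ : ℝ, Tendsto (fun r : ℝ => Real.Gamma (1 + σ) * (lam * r ^ 2 / 2 *
      besselEntire (σ + 1) (lam * r ^ 2 / 4))) (𝓝[>] 0) (𝓝 0) := by
    intro σ
    have : Continuous fun r : ℝ => Real.Gamma (1 + σ) * (lam * r ^ 2 / 2 *
      besselEntire (σ + 1) (lam * r ^ 2 / 4)) := by
      have := continuous_besselEntire (σ + 1)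
      fun_prop
    simpa using (this.tendsto 0).mono_left nhdsWithin_le_nhds
  have a1 := tendsto_Gamma_mul_besselEntire (by linarith : -1 < p) lam
  have a2 := tendsto_Gamma_mul_besselEntire (by linarith : -1 < -p) lam
  have b1 := (a1.const_mul p).add (lim0 p)
  have b2 := (a2.const_mul (-p)).add (lim0 (-p))
  have lim := (a1.mul b2).sub (b1.mul a2)
  have hlim : Tendsto (fun r : ℝ => (r : ℂ) * ((frobenius p lam r : ℂ) *
      (frobeniusDeriv (-p) lam r : ℂ) - (frobeniusDeriv p lam r : ℂ) * (frobenius (-p) lam r : ℂ)))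
      (𝓝[>] 0) (𝓝 (((1 * (-p * 1 + 0) - (p * 1 + 0) * 1 : ℝ)) : ℂ)) := by
    refine ((Complex.continuous_ofReal.tendsto _).comp lim).congr' ?_
    filter_upwards [self_mem_nhdsWithin] with x hx
    have hx0 : x ≠ 0 := ne_of_gt hx
    have hxp : x ^ p * x ^ (-p) = 1 := by rw [← Real.rpow_add hx]; simp
    simp only [Function.comp]
    rw [← Complex.ofReal_mul, ← Complex.ofReal_mul, ← Complex.ofReal_sub, ← Complex.ofReal_mul]
    congr 1
    simp only [frobenius, frobeniusDeriv]
    field_simp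
    linear_combination (-(Real.Gamma (1 + -p) *
      (besselEntire p (lam * x ^ 2 / 4) * (-(p * besselEntire (-p) (lam * x ^ 2 / 4) * 2) +
      x ^ 2 * lam * besselEntire (-p + 1) (lam * x ^ 2 / 4)) -
      besselEntire (-p) (lam * x ^ 2 / 4) * (p * besselEntire p (lam * x ^ 2 / 4) * 2 +
      x ^ 2 * lam * besselEntire (p + 1) (lam * x ^ 2 / 4))))) * hxp
  have hc : Tendsto (fun r : ℝ => (r : ℂ) * ((frobenius p lam r : ℂ) *
      (frobeniusDeriv (-p) lam r : ℂ) - (frobeniusDeriv p lam r : ℂ) * (frobenius (-p) lam r : ℂ)))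
      (𝓝[>] 0) (𝓝 W) := by
    refine tendsto_const_nhds.congr' ?_
    filter_upwards [self_mem_nhdsWithin] with x hx
    exact (hW x hx).symm
  rw [tendsto_nhds_unique hc hlim]
  push_cast
  ring

/-- The two Frobenius solutions span the solution space. -/
lemma IsRadialSolution.exists_frobenius {p lam : ℝ} (hp0 : 0 < p) (hp1 : p < 1) {u u' : ℝ → ℂ}
    (hu : IsRadialSolution p lam u u') :
    ∃ a b : ℂ, ∀ r : ℝ, 0 < r →
      u r = a * frobenius p lam r + b * frobenius (-p) lam r ∧
      u' r = a * frobeniusDeriv p lam r + b * frobeniusDeriv (-p) lam r := by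
  have s1 := isRadialSolution_frobenius (index_ne_of_gt (by linarith : -1 < p)) rfl lam
  have s2 := isRadialSolution_frobenius (index_ne_of_gt (by linarith : -1 < -p)) (neg_sq p) lam
  obtain ⟨W1, h1⟩ := hu.wronskian_const s1
  obtain ⟨W2, h2⟩ := hu.wronskian_const s2
  have hp : (p : ℂ) ≠ 0 := Complex.ofReal_ne_zero.2 hp0.ne'
  refine ⟨-W2 / (2 * p), W1 / (2 * p), fun r hr => ?_⟩
  have h0 := wronskian_frobenius hp0 hp1 lam hr
  rw [← h1 r hr, ← h2 r hr]
  constructor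
  · field_simp
    linear_combination u r * h0
  · field_simp
    linear_combination u' r * h0

/-! ### Boundary values at the origin -/

lemma HasBoundaryValues.unique {j : ℝ} {ψ : ℝ → ℂ} {c₀ c₁ d₀ d₁ : ℂ}
    (h : HasBoundaryValues j ψ c₀ c₁) (h' : HasBoundaryValues j ψ d₀ d₁) : c₀ = d₀ ∧ c₁ = d₁ := by
  obtain rfl := tendsto_nhds_unique h.1 h'.1
  exact ⟨rfl, tendsto_nhds_unique h.2 h'.2⟩

lemma HasBoundaryValues.congr {j : ℝ} {ψ χ : ℝ → ℂ} {c₀ c₁ : ℂ}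
    (h : HasBoundaryValues j ψ c₀ c₁) (hψ : ∀ r : ℝ, 0 < r → χ r = ψ r) :
    HasBoundaryValues j χ c₀ c₁ := by
  refine ⟨h.1.congr' ?_, h.2.congr' ?_⟩ <;>
  · filter_upwards [self_mem_nhdsWithin] with r hr
    rw [hψ r hr]

lemma tendsto_rpow_zero_right {s : ℝ} (hs : 0 < s) :
    Tendsto (fun r : ℝ => r ^ s) (𝓝[>] 0) (𝓝 0) := by
  have := (Real.continuousAt_rpow_const 0 s (Or.inr hs.le)).tendsto
  rw [Real.zero_rpow hs.ne'] at this
  exact this.mono_left nhdsWithin_le_nhds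

/-- `r^{-p}` times the correction of `Φ_{-p}` to its leading term is `O(r^{2-2p})`. -/
lemma tendsto_frobenius_neg_remainder {p : ℝ} (hp1 : p < 1) (lam : ℝ) :
    Tendsto (fun r : ℝ => 1 / r ^ p * (frobenius (-p) lam r - 1 / r ^ p)) (𝓝[>] 0) (𝓝 0) := by
  have hd := hasDerivAt_besselEntire (-p) 0
  set G := Real.Gamma (1 + -p) with hG
  have hG0 : G * besselEntire (-p) 0 = 1 := by
    rw [besselEntire_zero, mul_one_div_cancel (Real.Gamma_pos_of_pos (by linarith)).ne']
  -- a continuous difference quotient of the entire series at `0`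
  have hcont : Continuous (dslope (besselEntire (-p)) 0) := by
    rw [continuous_iff_continuousAt]
    intro w
    by_cases hw : w = 0
    · subst hw
      exact continuousAt_dslope_same.2 hd.differentiableAt
    · exact (continuousAt_dslope_of_ne hw).2 (continuous_besselEntire _).continuousAt
  have h1 : Tendsto (fun r : ℝ => G * (lam / 4) * dslope (besselEntire (-p)) 0 (lam * r ^ 2 / 4) *
      r ^ (2 - 2 * p)) (𝓝[>] 0) (𝓝 0) := by
    have := (((hcont.tendsto 0).comp (tendsto_lam_sq lam)).const_mul (G * (lam / 4))).mul
      (tendsto_rpow_zero_right (by linarith : 0 < 2 - 2 * p))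
    simpa using this
  refine h1.congr' ?_
  filter_upwards [self_mem_nhdsWithin] with r hr
  have hr0 : (0 : ℝ) < r := hr
  have e := sub_smul_dslope (besselEntire (-p)) 0 (lam * r ^ 2 / 4)
  have hp2 : r ^ (2 - 2 * p) = r ^ 2 * (r ^ (-p) * r ^ (-p)) := by
    rw [← Real.rpow_add hr0, show (r ^ 2 : ℝ) = r ^ (2 : ℝ) by norm_cast, ← Real.rpow_add hr0]
    congr 1
    ring
  simp only [sub_zero, smul_eq_mul] at e
  rw [frobenius, hp2, one_div, ← Real.rpow_neg hr0.le, ← hG]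
  linear_combination (G * (r ^ (-p) * r ^ (-p))) * e - (r ^ (-p)) * r ^ (-p) * hG0

lemma hasBoundaryValues_frobenius {j : ℝ} (hj0 : 0 < |j|) (hj1 : |j| < 1) (lam : ℝ) (a b : ℂ) :
    HasBoundaryValues j (fun r => a * frobenius |j| lam r + b * frobenius (-|j|) lam r) b a := by
  set p := |j| with hp
  have t1 : Tendsto (fun r : ℝ => 1 / r ^ p * frobenius p lam r) (𝓝[>] 0) (𝓝 1) := by
    refine (tendsto_Gamma_mul_besselEntire (by linarith : -1 < p) lam).congr' ?_
    filter_upwards [self_mem_nhdsWithin] with r hr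
    have : r ^ p ≠ 0 := (Real.rpow_pos_of_pos hr p).ne'
    rw [frobenius]
    field_simp
  have t2 : Tendsto (fun r : ℝ => r ^ p * frobenius (-p) lam r) (𝓝[>] 0) (𝓝 1) := by
    refine (tendsto_Gamma_mul_besselEntire (by linarith : -1 < -p) lam).congr' ?_
    filter_upwards [self_mem_nhdsWithin] with r hr
    have : r ^ p * r ^ (-p) = 1 := by rw [← Real.rpow_add hr]; simp
    rw [frobenius]
    linear_combination -(Real.Gamma (1 + -p) * besselEntire (-p) (lam * r ^ 2 / 4)) * this
  have t3 : Tendsto (fun r : ℝ => r ^ p * frobenius p lam r) (𝓝[>] 0) (𝓝 0) := by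
    have := t1.mul (tendsto_rpow_zero_right (by linarith : 0 < p + p))
    rw [mul_zero] at this
    refine this.congr' ?_
    filter_upwards [self_mem_nhdsWithin] with r hr
    have h : r ^ p ≠ 0 := (Real.rpow_pos_of_pos hr p).ne'
    rw [Real.rpow_add hr]
    field_simp
  have t4 := tendsto_frobenius_neg_remainder hj1 lam
  have c {f : ℝ → ℝ} {l : ℝ} (h : Tendsto f (𝓝[>] 0) (𝓝 l)) :
      Tendsto (fun r => (f r : ℂ)) (𝓝[>] 0) (𝓝 (l : ℂ)) :=
    (Complex.continuous_ofReal.tendsto _).comp h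
  constructor
  · have := ((c t3).const_mul a).add ((c t2).const_mul b)
    simp only [Complex.ofReal_zero, mul_zero, zero_add, Complex.ofReal_one, mul_one] at this
    refine this.congr fun r => ?_
    push_cast
    ring
  · have := ((c t1).const_mul a).add ((c t4).const_mul b)
    simp only [Complex.ofReal_zero, mul_zero, add_zero, Complex.ofReal_one, mul_one] at this
    refine this.congr fun r => ?_
    push_cast
    ring

/-! ### The Laplace integral of the decaying solution -/

/-- `∫₀^∞ e^{-xs} s^b (s + 2c)^a ds`. The decaying solution needs `b = a` only; differentiation in
`x` raises `b`. -/
noncomputable def laplaceIntegral (a : ℝ) (c : ℂ) (b x : ℝ) : ℂ :=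
  ∫ s in Set.Ioi (0 : ℝ), ((Real.exp (-(x * s)) * s ^ b : ℝ) : ℂ) * ((s : ℂ) + 2 * c) ^ (a : ℂ)

lemma norm_two_mul_le {c : ℂ} (hc : 0 ≤ c.re) {s : ℝ} (hs : 0 ≤ s) :
    ‖2 * c‖ ≤ ‖(s : ℂ) + 2 * c‖ := by
  rw [← sq_le_sq₀ (norm_nonneg _) (norm_nonneg _), Complex.sq_norm, Complex.sq_norm,
    Complex.normSq_apply, Complex.normSq_apply]
  simp only [Complex.add_re, Complex.add_im, Complex.mul_re, Complex.mul_im, Complex.ofReal_re,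
    Complex.ofReal_im, Complex.re_ofNat, Complex.im_ofNat]
  nlinarith [mul_nonneg hs hc, sq_nonneg s]

lemma le_norm_add {c : ℂ} (hc : 0 ≤ c.re) (s : ℝ) : s ≤ ‖(s : ℂ) + 2 * c‖ := by
  refine le_trans ?_ (Complex.re_le_norm _)
  simpa using hc

lemma add_mem_slitPlane {c : ℂ} (hc : 0 ≤ c.re) (hc0 : c ≠ 0) {s : ℝ} (hs : 0 ≤ s) :
    (s : ℂ) + 2 * c ∈ Complex.slitPlane := by
  rw [Complex.mem_slitPlane_iff]
  by_cases h : c.im = 0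
  · left
    have : 0 < c.re := lt_of_le_of_ne hc fun h' => hc0 (Complex.ext h'.symm h)
    simp
    linarith
  · right
    simpa using h

lemma exists_norm_cpow_le {a : ℝ} (ha : a ≤ 1) {c : ℂ} (hc : 0 ≤ c.re) (hc0 : c ≠ 0) :
    ∃ M : ℝ, 0 < M ∧ ∀ s : ℝ, 0 ≤ s → ‖((s : ℂ) + 2 * c) ^ (a : ℂ)‖ ≤ M * (1 + s) := by
  have h2 : 0 < ‖2 * c‖ := norm_pos_iff.2 (mul_ne_zero two_ne_zero hc0)
  rcases le_or_gt 0 a with h | h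
  · refine ⟨1 + ‖2 * c‖, by positivity, fun s hs => ?_⟩
    rw [Complex.norm_cpow_real]
    calc ‖(s : ℂ) + 2 * c‖ ^ a ≤ (1 + (s + ‖2 * c‖)) ^ a := by
          gcongr
          refine (norm_add_le _ _).trans ?_
          rw [Complex.norm_of_nonneg hs]
          linarith
      _ ≤ (1 + (s + ‖2 * c‖)) ^ (1 : ℝ) := by
          apply Real.rpow_le_rpow_of_exponent_le _ ha
          linarith
      _ ≤ _ := by
          rw [Real.rpow_one]
          nlinarith
  · refine ⟨‖2 * c‖ ^ a, by positivity, fun s hs => ?_⟩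
    rw [Complex.norm_cpow_real]
    calc ‖(s : ℂ) + 2 * c‖ ^ a ≤ ‖2 * c‖ ^ a :=
          Real.rpow_le_rpow_of_nonpos h2 (norm_two_mul_le hc hs) h.le
      _ ≤ _ := le_mul_of_one_le_right (by positivity) (by linarith)

lemma integrableOn_exp_mul_rpow {b x : ℝ} (hb : -1 < b) (hx : 0 < x) :
    IntegrableOn (fun s : ℝ => Real.exp (-(x * s)) * s ^ b) (Set.Ioi 0) := by
  refine (integrableOn_rpow_mul_exp_neg_mul_rpow hb one_pos hx).congr_fun (fun s _ => ?_)
    measurableSet_Ioi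
  simp only [Real.rpow_one]
  rw [neg_mul, mul_comm]

lemma integrableOn_exp_mul_rpow_mul {b x : ℝ} (hb : -1 < b) (hx : 0 < x) (M : ℝ) :
    IntegrableOn (fun s : ℝ => Real.exp (-(x * s)) * s ^ b * (M * (1 + s))) (Set.Ioi 0) := by
  have h : IntegrableOn (fun s : ℝ => M * (Real.exp (-(x * s)) * s ^ b) +
      M * (Real.exp (-(x * s)) * s ^ (b + 1))) (Set.Ioi 0) :=
    ((integrableOn_exp_mul_rpow hb hx).const_mul M).add
      ((integrableOn_exp_mul_rpow (by linarith) hx).const_mul M)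
  refine h.congr_fun (fun s hs => ?_) measurableSet_Ioi
  simp only
  rw [Real.rpow_add_one (ne_of_gt hs)]
  ring

lemma continuousOn_cpow {a : ℝ} {c : ℂ} (hc : 0 ≤ c.re) (hc0 : c ≠ 0) :
    ContinuousOn (fun s : ℝ => ((s : ℂ) + 2 * c) ^ (a : ℂ)) (Set.Ici 0) := by
  intro s hs
  refine ContinuousAt.continuousWithinAt ?_
  exact ContinuousAt.cpow (by fun_prop) continuousAt_const (add_mem_slitPlane hc hc0 hs)

lemma continuousOn_laplace_integrand {a : ℝ} {c : ℂ} (hc : 0 ≤ c.re) (hc0 : c ≠ 0) (b x : ℝ) :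
    ContinuousOn (fun s : ℝ => ((Real.exp (-(x * s)) * s ^ b : ℝ) : ℂ) *
      ((s : ℂ) + 2 * c) ^ (a : ℂ)) (Set.Ioi 0) := by
  refine ContinuousOn.mul ?_ ((continuousOn_cpow hc hc0).mono Set.Ioi_subset_Ici_self)
  refine Complex.continuous_ofReal.comp_continuousOn (ContinuousOn.mul (by fun_prop) ?_)
  exact fun s hs => (Real.continuousAt_rpow_const s b (Or.inl (ne_of_gt hs))).continuousWithinAt

lemma norm_laplace_integrand_le {a M : ℝ} {c : ℂ}
    (hM : ∀ s : ℝ, 0 ≤ s → ‖((s : ℂ) + 2 * c) ^ (a : ℂ)‖ ≤ M * (1 + s)) (b x : ℝ) {s : ℝ}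
    (hs : 0 < s) :
    ‖((Real.exp (-(x * s)) * s ^ b : ℝ) : ℂ) * ((s : ℂ) + 2 * c) ^ (a : ℂ)‖ ≤
      Real.exp (-(x * s)) * s ^ b * (M * (1 + s)) := by
  rw [norm_mul, Complex.norm_of_nonneg (by positivity)]
  gcongr
  exact hM s hs.le

lemma integrableOn_laplace_integrand {a : ℝ} (ha : a ≤ 1) {c : ℂ} (hc : 0 ≤ c.re) (hc0 : c ≠ 0)
    {b x : ℝ} (hb : -1 < b) (hx : 0 < x) :
    IntegrableOn (fun s : ℝ => ((Real.exp (-(x * s)) * s ^ b : ℝ) : ℂ) *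
      ((s : ℂ) + 2 * c) ^ (a : ℂ)) (Set.Ioi 0) := by
  obtain ⟨M, _, hM⟩ := exists_norm_cpow_le ha hc hc0
  refine (integrableOn_exp_mul_rpow_mul hb hx M).mono'
    ((continuousOn_laplace_integrand hc hc0 b x).aestronglyMeasurable measurableSet_Ioi) ?_
  filter_upwards [ae_restrict_mem measurableSet_Ioi] with s hs
  exact norm_laplace_integrand_le hM b x hs

lemma hasDerivAt_laplaceIntegral {a : ℝ} (ha : a ≤ 1) {c : ℂ} (hc : 0 ≤ c.re) (hc0 : c ≠ 0)
    {b x : ℝ} (hb : -1 < b) (hx : 0 < x) :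
    HasDerivAt (laplaceIntegral a c b) (-laplaceIntegral a c (b + 1) x) x := by
  obtain ⟨M, hM0, hM⟩ := exists_norm_cpow_le ha hc hc0
  have key := hasDerivAt_integral_of_dominated_loc_of_deriv_le
    (μ := volume.restrict (Set.Ioi (0 : ℝ))) (x₀ := x) (s := Metric.ball x (x / 2))
    (F := fun x s : ℝ => ((Real.exp (-(x * s)) * s ^ b : ℝ) : ℂ) * ((s : ℂ) + 2 * c) ^ (a : ℂ))
    (F' := fun x s : ℝ =>
      -(((Real.exp (-(x * s)) * s ^ (b + 1) : ℝ) : ℂ) * ((s : ℂ) + 2 * c) ^ (a : ℂ)))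
    (bound := fun s : ℝ => Real.exp (-(x / 2 * s)) * s ^ (b + 1) * (M * (1 + s)))
    (Metric.ball_mem_nhds x (by positivity))
    (Eventually.of_forall fun y =>
      (continuousOn_laplace_integrand hc hc0 b y).aestronglyMeasurable measurableSet_Ioi)
    (integrableOn_laplace_integrand ha hc hc0 hb hx)
    ((continuousOn_laplace_integrand hc hc0 (b + 1) x).aestronglyMeasurable measurableSet_Ioi).neg
    ?_ (integrableOn_exp_mul_rpow_mul (by linarith) (by positivity) M) ?_
  · convert! key.2 using 1
    rw [laplaceIntegral, integral_neg]
  · filter_upwards [ae_restrict_mem measurableSet_Ioi] with s hs y hy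
    have hs0 : (0 : ℝ) < s := hs
    rw [norm_neg]
    refine (norm_laplace_integrand_le hM (b + 1) y hs).trans ?_
    gcongr
    rw [Metric.mem_ball, Real.dist_eq] at hy
    linarith [(abs_lt.1 hy).1]
  · filter_upwards [ae_restrict_mem measurableSet_Ioi] with s hs y _
    have hs0 : s ≠ 0 := ne_of_gt hs
    have h1 : HasDerivAt (fun y : ℝ => Real.exp (-(y * s)) * s ^ b)
        (-(Real.exp (-(y * s)) * s ^ (b + 1))) y := by
      have := (((hasDerivAt_id y).mul_const s).neg.exp).mul_const (s ^ b)
      convert! this using 1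
      rw [Real.rpow_add_one hs0]
      simp only [id, Pi.neg_apply]
      ring
    convert! h1.ofReal_comp.mul_const (((s : ℂ) + 2 * c) ^ (a : ℂ)) using 1
    push_cast
    ring

/-- Integration of the total derivative of `e^{-xs} (s² + 2cs)^{a+1}`. -/
lemma laplaceIntegral_recurrence {a : ℝ} (ha0 : -1 < a) (ha : a ≤ 1) {c : ℂ} (hc : 0 ≤ c.re)
    (hc0 : c ≠ 0) {x : ℝ} (hx : 0 < x) :
    (x : ℂ) * (laplaceIntegral a c (a + 2) x + 2 * c * laplaceIntegral a c (a + 1) x) =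
      (2 * a + 2) * (laplaceIntegral a c (a + 1) x + c * laplaceIntegral a c a x) := by
  have i0 := integrableOn_laplace_integrand ha hc hc0 (b := a) (by linarith) hx
  have i1 := integrableOn_laplace_integrand ha hc hc0 (b := a + 1) (by linarith) hx
  have i2 := integrableOn_laplace_integrand ha hc hc0 (b := a + 2) (by linarith) hx
  set g : ℝ → ℝ → ℂ := fun b s => ((Real.exp (-(x * s)) * s ^ b : ℝ) : ℂ) *
    ((s : ℂ) + 2 * c) ^ (a : ℂ) with hg
  -- the function `e^{-xs} s^{a+1} (s+2c)^{a+1}` and its derivative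
  have hF : ∀ s ∈ Set.Ioi (0 : ℝ), HasDerivAt
      (fun s : ℝ => ((Real.exp (-(x * s)) * s ^ (a + 1) : ℝ) : ℂ) *
        ((s : ℂ) + 2 * c) ^ ((a : ℂ) + 1))
      ((2 * a + 2) * (g (a + 1) s + c * g a s) - x * (g (a + 2) s + 2 * c * g (a + 1) s)) s := by
    intro s hs
    have hs0 : (0 : ℝ) < s := hs
    have hm := add_mem_slitPlane hc hc0 hs0.le
    have hne := Complex.slitPlane_ne_zero hm
    have h1 : HasDerivAt (fun s : ℝ => Real.exp (-(x * s)) * s ^ (a + 1))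
        (Real.exp (-(x * s)) * (-x) * s ^ (a + 1) +
          Real.exp (-(x * s)) * ((a + 1) / s * s ^ (a + 1))) s := by
      have := (((hasDerivAt_id s).const_mul x).neg.exp).mul (hasDerivAt_rpow_div (σ := a + 1) hs0)
      convert! this using 1
      simp
    have h2 : HasDerivAt (fun s : ℝ => ((s : ℂ) + 2 * c) ^ ((a : ℂ) + 1))
        (((a : ℂ) + 1) * ((s : ℂ) + 2 * c) ^ (a : ℂ)) s := by
      have h3 : HasDerivAt (fun s : ℝ => (s : ℂ) + 2 * c) 1 s := by
        simpa using (hasDerivAt_id s).ofReal_comp.add_const (2 * c)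
      have h4 := (hasDerivAt_id ((s : ℂ) + 2 * c)).cpow_const (c := (a : ℂ) + 1) hm
      convert! h4.comp s h3 using 1
      simp
    convert! h1.ofReal_comp.mul h2 using 1
    simp only [hg]
    rw [Complex.cpow_add _ _ hne, Complex.cpow_one, show a + 2 = a + 1 + 1 by ring,
      Real.rpow_add_one hs0.ne' (a + 1), Real.rpow_add_one hs0.ne' a]
    have : (s : ℂ) ≠ 0 := Complex.ofReal_ne_zero.2 hs0.ne'
    push_cast
    field_simp
    ring
  have hint1 : IntegrableOn (fun s => (2 * a + 2) * (g (a + 1) s + c * g a s) -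
      x * (g (a + 2) s + 2 * c * g (a + 1) s)) (Set.Ioi 0) :=
    ((i1.add (i0.const_mul c)).const_mul (2 * a + 2)).sub
      ((i2.add (i1.const_mul (2 * c))).const_mul x)
  have hint2 : IntegrableOn (fun s : ℝ => ((Real.exp (-(x * s)) * s ^ (a + 1) : ℝ) : ℂ) *
      ((s : ℂ) + 2 * c) ^ ((a : ℂ) + 1)) (Set.Ioi 0) := by
    refine (i2.add (i1.const_mul (2 * c))).congr_fun (fun s hs => ?_) measurableSet_Ioi
    have hs0 : (0 : ℝ) < s := hs
    have hne := Complex.slitPlane_ne_zero (add_mem_slitPlane hc hc0 hs0.le)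
    simp only [Pi.add_apply]
    rw [Complex.cpow_add _ _ hne, Complex.cpow_one, show a + 2 = a + 1 + 1 by ring,
      Real.rpow_add_one hs0.ne' (a + 1)]
    push_cast
    ring
  have hcont : ContinuousWithinAt (fun s : ℝ => ((Real.exp (-(x * s)) * s ^ (a + 1) : ℝ) : ℂ) *
      ((s : ℂ) + 2 * c) ^ ((a : ℂ) + 1)) (Set.Ici 0) 0 := by
    refine ContinuousAt.continuousWithinAt ?_
    refine ContinuousAt.mul ?_ ?_
    · refine Complex.continuous_ofReal.continuousAt.comp (ContinuousAt.mul (by fun_prop) ?_)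
      exact Real.continuousAt_rpow_const 0 _ (Or.inr (by linarith))
    · exact ContinuousAt.cpow (by fun_prop) continuousAt_const (add_mem_slitPlane hc hc0 le_rfl)
  have hlim := tendsto_zero_of_hasDerivAt_of_integrableOn_Ioi hF hint1 hint2
  have h := integral_Ioi_of_hasDerivAt_of_tendsto hcont hF hint1 hlim
  rw [Real.zero_rpow (by linarith)] at h
  simp only [mul_zero, Complex.ofReal_zero, zero_mul, sub_zero] at h
  have e1 : ∫ s in Set.Ioi (0 : ℝ), (g (a + 1) s + c * g a s) =
      laplaceIntegral a c (a + 1) x + c * laplaceIntegral a c a x := by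
    rw [integral_add i1 (i0.const_mul c), integral_const_mul]
    rfl
  have e2 : ∫ s in Set.Ioi (0 : ℝ), (g (a + 2) s + 2 * c * g (a + 1) s) =
      laplaceIntegral a c (a + 2) x + 2 * c * laplaceIntegral a c (a + 1) x := by
    rw [integral_add i2 (i1.const_mul (2 * c)), integral_const_mul]
    rfl
  rw [integral_sub (f := fun s => (2 * a + 2) * (g (a + 1) s + c * g a s))
    (g := fun s => x * (g (a + 2) s + 2 * c * g (a + 1) s))
    ((i1.add (i0.const_mul c)).const_mul (2 * a + 2))
    ((i2.add (i1.const_mul (2 * c))).const_mul x), integral_const_mul, integral_const_mul, e1,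
    e2] at h
  linear_combination -h

lemma rpow_mul_laplaceIntegral (a : ℝ) (c : ℂ) (b : ℝ) {x : ℝ} (hx : 0 < x) :
    ((x ^ (b + 1) : ℝ) : ℂ) * laplaceIntegral a c b x =
      ∫ u in Set.Ioi (0 : ℝ), ((Real.exp (-u) * u ^ b : ℝ) : ℂ) *
        (((u / x : ℝ) : ℂ) + 2 * c) ^ (a : ℂ) := by
  have h := integral_comp_mul_left_Ioi' (fun u : ℝ => ((Real.exp (-u) * u ^ b : ℝ) : ℂ) *
        (((u / x : ℝ) : ℂ) + 2 * c) ^ (a : ℂ)) 0 hx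
  rw [mul_zero] at h
  rw [← h, laplaceIntegral, ← integral_const_mul, ← integral_smul]
  refine setIntegral_congr_fun measurableSet_Ioi fun s hs => ?_
  have hs0 : (0 : ℝ) < s := hs
  simp only [Complex.real_smul]
  rw [mul_div_cancel_left₀ _ hx.ne', Real.mul_rpow hx.le hs0.le, Real.rpow_add_one hx.ne']
  push_cast
  ring

lemma integral_exp_mul_rpow {b : ℝ} (hb : -1 < b) :
    ∫ u in Set.Ioi (0 : ℝ), Real.exp (-u) * u ^ b = Real.Gamma (b + 1) := by
  rw [Real.Gamma_eq_integral (by linarith)]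
  simp

lemma tendsto_laplaceIntegral_atTop {a : ℝ} (ha : a ≤ 1) {c : ℂ} (hc : 0 ≤ c.re) (hc0 : c ≠ 0)
    {b : ℝ} (hb : -1 < b) :
    Tendsto (fun x : ℝ => ((x ^ (b + 1) : ℝ) : ℂ) * laplaceIntegral a c b x) atTop
      (𝓝 ((2 * c) ^ (a : ℂ) * Real.Gamma (b + 1))) := by
  obtain ⟨M, hM0, hM⟩ := exists_norm_cpow_le ha hc hc0
  have key : Tendsto (fun x : ℝ => ∫ u in Set.Ioi (0 : ℝ), ((Real.exp (-u) * u ^ b : ℝ) : ℂ) *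
        (((u / x : ℝ) : ℂ) + 2 * c) ^ (a : ℂ)) atTop
      (𝓝 (∫ u in Set.Ioi (0 : ℝ), ((Real.exp (-u) * u ^ b : ℝ) : ℂ) * (2 * c) ^ (a : ℂ))) := by
    refine tendsto_integral_filter_of_dominated_convergence
      (fun u => Real.exp (-(1 * u)) * u ^ b * (M * (1 + u))) ?_ ?_
      (integrableOn_exp_mul_rpow_mul hb one_pos M) ?_
    · filter_upwards [eventually_gt_atTop 0] with x hx
      refine ContinuousOn.aestronglyMeasurable ?_ measurableSet_Ioi
      refine ContinuousOn.mul ?_ ?_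
      · refine Complex.continuous_ofReal.comp_continuousOn (ContinuousOn.mul (by fun_prop) ?_)
        exact fun s hs =>
          (Real.continuousAt_rpow_const s b (Or.inl (ne_of_gt hs))).continuousWithinAt
      · intro u hu
        refine ContinuousAt.continuousWithinAt ?_
        exact ContinuousAt.cpow (by fun_prop) continuousAt_const
          (add_mem_slitPlane hc hc0 (div_nonneg (le_of_lt hu) hx.le))
    · filter_upwards [eventually_ge_atTop 1] with x hx
      filter_upwards [ae_restrict_mem measurableSet_Ioi] with u hu
      have hu0 : (0 : ℝ) < u := hu
      rw [norm_mul, Complex.norm_of_nonneg (by positivity), one_mul]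
      gcongr
      refine (hM _ (by positivity)).trans ?_
      gcongr
      exact div_le_self hu0.le hx
    · filter_upwards with u
      refine Tendsto.const_mul _ ?_
      have h0 : Tendsto (fun x : ℝ => ((u / x : ℝ) : ℂ) + 2 * c) atTop (𝓝 (2 * c)) := by
        have := (((Complex.continuous_ofReal.tendsto _).comp
          (tendsto_const_nhds.div_atTop tendsto_id :
            Tendsto (fun x : ℝ => u / x) atTop (𝓝 0)))).add_const (2 * c)
        simpa using this
      have h2 : 2 * c ∈ Complex.slitPlane := by simpa using add_mem_slitPlane hc hc0 le_rfl
      exact (ContinuousAt.cpow continuousAt_id continuousAt_const h2 : ContinuousAt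
        (fun z : ℂ => z ^ (a : ℂ)) (2 * c)).tendsto.comp h0
  rw [integral_mul_const, integral_complex_ofReal, integral_exp_mul_rpow hb,
    mul_comm (Real.Gamma (b + 1) : ℂ)] at key
  refine key.congr' ?_
  filter_upwards [eventually_gt_atTop 0] with x hx
  exact (rpow_mul_laplaceIntegral a c b hx).symm

lemma ofReal_mul_cpow {x : ℝ} (hx : 0 < x) {z : ℂ} (hz : z ≠ 0) (w : ℂ) :
    ((x : ℂ) * z) ^ w = (x : ℂ) ^ w * z ^ w := by
  have hx' : (x : ℂ) ≠ 0 := Complex.ofReal_ne_zero.2 hx.ne'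
  rw [Complex.cpow_def_of_ne_zero (mul_ne_zero hx' hz), Complex.cpow_def_of_ne_zero hx',
    Complex.cpow_def_of_ne_zero hz, Complex.log_ofReal_mul hx hz, Complex.ofReal_log hx.le,
    ← Complex.exp_add, add_mul]

lemma cpow_div_add {a : ℝ} {c : ℂ} (hc : 0 ≤ c.re) (hc0 : c ≠ 0) {u : ℝ} (hu : 0 ≤ u) {x : ℝ}
    (hx : 0 < x) :
    ((x ^ a : ℝ) : ℂ) * (((u / x : ℝ) : ℂ) + 2 * c) ^ (a : ℂ) =
      ((u : ℂ) + 2 * (x * c)) ^ (a : ℂ) := by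
  have hx' : (x : ℂ) ≠ 0 := Complex.ofReal_ne_zero.2 hx.ne'
  have hz := Complex.slitPlane_ne_zero (add_mem_slitPlane hc hc0 (div_nonneg hu hx.le))
  rw [Complex.ofReal_cpow hx.le, ← ofReal_mul_cpow hx hz]
  congr 1
  push_cast
  field_simp

lemma tendsto_laplaceIntegral_zero {a : ℝ} (ha0 : -1 / 2 < a) (ha : a ≤ 1) {c : ℂ}
    (hc : 0 ≤ c.re) (hc0 : c ≠ 0) :
    Tendsto (fun x : ℝ => ((x ^ (2 * a + 1) : ℝ) : ℂ) * laplaceIntegral a c a x) (𝓝[>] 0)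
      (𝓝 (Real.Gamma (2 * a + 1))) := by
  have key : Tendsto (fun x : ℝ => ∫ u in Set.Ioi (0 : ℝ), ((Real.exp (-u) * u ^ a : ℝ) : ℂ) *
        ((u : ℂ) + 2 * (x * c)) ^ (a : ℂ)) (𝓝[>] 0)
      (𝓝 (∫ u in Set.Ioi (0 : ℝ), ((Real.exp (-u) * u ^ a : ℝ) : ℂ) * (u : ℂ) ^ (a : ℂ))) := by
    refine tendsto_integral_filter_of_dominated_convergence
      (fun u => Real.exp (-(1 * u)) * u ^ a * ((1 + ‖2 * c‖) * (1 + u)) +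
        Real.exp (-(1 * u)) * u ^ (2 * a)) ?_ ?_
      ((integrableOn_exp_mul_rpow_mul (by linarith) one_pos _).add
        (integrableOn_exp_mul_rpow (by linarith) one_pos)) ?_
    · filter_upwards [self_mem_nhdsWithin] with x hx
      have hx0 : (0 : ℝ) < x := hx
      have := continuousOn_laplace_integrand (a := a) (c := x * c)
        (by simpa using mul_nonneg hx0.le hc)
        (mul_ne_zero (Complex.ofReal_ne_zero.2 hx0.ne') hc0) a 1
      simp only [one_mul] at this
      exact this.aestronglyMeasurable measurableSet_Ioi
    · filter_upwards [Ioo_mem_nhdsGT one_pos] with x hx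
      filter_upwards [ae_restrict_mem measurableSet_Ioi] with u hu
      have hu0 : (0 : ℝ) < u := hu
      have hre : 0 ≤ ((x : ℂ) * c).re := by simpa using mul_nonneg hx.1.le hc
      have hxn : ‖2 * ((x : ℂ) * c)‖ ≤ ‖2 * c‖ := by
        rw [mul_left_comm, norm_mul, Complex.norm_of_nonneg hx.1.le]
        exact mul_le_of_le_one_left (norm_nonneg _) hx.2.le
      rw [norm_mul, Complex.norm_of_nonneg (by positivity), one_mul, two_mul a, Real.rpow_add hu0,
        ← mul_assoc (Real.exp (-u)) (u ^ a) (u ^ a), ← mul_add]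
      gcongr
      rw [Complex.norm_cpow_real]
      rcases le_or_gt 0 a with h | h
      · have h1 : ‖(u : ℂ) + 2 * (x * c)‖ ^ a ≤ (1 + ‖2 * c‖) * (1 + u) := by
          calc ‖(u : ℂ) + 2 * (x * c)‖ ^ a ≤ (1 + (u + ‖2 * c‖)) ^ a := by
                gcongr
                refine (norm_add_le _ _).trans ?_
                rw [Complex.norm_of_nonneg hu0.le]
                linarith
            _ ≤ (1 + (u + ‖2 * c‖)) ^ (1 : ℝ) := by
                apply Real.rpow_le_rpow_of_exponent_le _ ha
                linarith [norm_nonneg (2 * c)]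
            _ ≤ _ := by
                rw [Real.rpow_one]
                nlinarith [norm_nonneg (2 * c)]
        have : 0 ≤ u ^ a := by positivity
        linarith
      · have h1 : ‖(u : ℂ) + 2 * (x * c)‖ ^ a ≤ u ^ a :=
          Real.rpow_le_rpow_of_nonpos hu0 (le_norm_add hre u) h.le
        have : 0 ≤ (1 + ‖2 * c‖) * (1 + u) := by positivity
        linarith
    · filter_upwards [ae_restrict_mem measurableSet_Ioi] with u hu
      refine Tendsto.const_mul _ ?_
      have h0 : Tendsto (fun x : ℝ => (u : ℂ) + 2 * (x * c)) (𝓝[>] 0) (𝓝 u) := by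
        have : Continuous fun x : ℝ => (u : ℂ) + 2 * (x * c) := by fun_prop
        simpa using (this.tendsto 0).mono_left nhdsWithin_le_nhds
      have h2 : (u : ℂ) ∈ Complex.slitPlane := Complex.ofReal_mem_slitPlane.2 hu
      exact (ContinuousAt.cpow continuousAt_id continuousAt_const h2 : ContinuousAt
        (fun z : ℂ => z ^ (a : ℂ)) u).tendsto.comp h0
  have hG : ∫ u in Set.Ioi (0 : ℝ), ((Real.exp (-u) * u ^ a : ℝ) : ℂ) * (u : ℂ) ^ (a : ℂ) =
      Real.Gamma (2 * a + 1) := by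
    rw [← integral_exp_mul_rpow (by linarith), ← integral_complex_ofReal]
    refine setIntegral_congr_fun measurableSet_Ioi fun u hu => ?_
    have hu0 : (0 : ℝ) < u := hu
    rw [← Complex.ofReal_cpow hu0.le, two_mul, Real.rpow_add hu0]
    push_cast
    ring
  rw [hG] at key
  refine key.congr' ?_
  filter_upwards [self_mem_nhdsWithin] with x hx
  have hx0 : (0 : ℝ) < x := hx
  rw [show 2 * a + 1 = a + (a + 1) by ring, Real.rpow_add hx0, Complex.ofReal_mul, mul_assoc,
    rpow_mul_laplaceIntegral a c a hx0, ← integral_const_mul]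
  refine setIntegral_congr_fun measurableSet_Ioi fun u hu => ?_
  rw [← cpow_div_add hc hc0 (le_of_lt hu) hx0]
  ring

/-! ### The decaying solution and its connection coefficients -/

/-- The solution `x^p e^{-cx} ∫₀^∞ e^{-xs} (s² + 2cs)^{p-1/2} ds` of the radial equation with
spectral parameter `c²`; up to a constant it is `K_p(cx)`. -/
noncomputable def decaying (p : ℝ) (c : ℂ) (x : ℝ) : ℂ :=
  ((x ^ p : ℝ) : ℂ) * Complex.exp (-(c * x)) * laplaceIntegral (p - 1 / 2) c (p - 1 / 2) x

/-- The derivative of `decaying`. -/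
noncomputable def decayingDeriv (p : ℝ) (c : ℂ) (x : ℝ) : ℂ :=
  ((x ^ p : ℝ) : ℂ) * Complex.exp (-(c * x)) *
    ((p / x - c) * laplaceIntegral (p - 1 / 2) c (p - 1 / 2) x -
      laplaceIntegral (p - 1 / 2) c (p - 1 / 2 + 1) x)

lemma isRadialSolution_decaying {p lam : ℝ} (hp0 : 0 < p) (hp1 : p < 1) {c : ℂ} (hc : 0 ≤ c.re)
    (hc0 : c ≠ 0) (hlam : c ^ 2 = lam) :
    IsRadialSolution p lam (decaying p c) (decayingDeriv p c) := by
  intro x hx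
  have hx' : (x : ℂ) ≠ 0 := Complex.ofReal_ne_zero.2 hx.ne'
  have d0 := hasDerivAt_laplaceIntegral (a := p - 1 / 2) (by linarith) hc hc0
    (b := p - 1 / 2) (by linarith) hx
  have d1 := hasDerivAt_laplaceIntegral (a := p - 1 / 2) (by linarith) hc hc0
    (b := p - 1 / 2 + 1) (by linarith) hx
  have hrec := laplaceIntegral_recurrence (a := p - 1 / 2) (by linarith) (by linarith) hc hc0 hx
  rw [show p - 1 / 2 + 1 + 1 = p - 1 / 2 + 2 by ring] at d1
  have dp : HasDerivAt (fun x : ℝ => ((x ^ p : ℝ) : ℂ)) (p / x * ((x ^ p : ℝ) : ℂ)) x := by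
    simpa using (hasDerivAt_rpow_div (σ := p) hx).ofReal_comp
  have de : HasDerivAt (fun x : ℝ => Complex.exp (-(c * x))) (-c * Complex.exp (-(c * x))) x := by
    have h := ((hasDerivAt_id x).ofReal_comp.const_mul c).neg.cexp
    convert! h using 1
    simp [mul_comm]
  have di : HasDerivAt (fun x : ℝ => (p : ℂ) / x - c) (-(p : ℂ) / x ^ 2) x := by
    have h := ((hasDerivAt_inv hx.ne').ofReal_comp.const_mul (p : ℂ)).sub_const c
    convert! h using 1
    · ext y
      simp [div_eq_mul_inv]
    · push_cast
      field_simp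
  refine ⟨?_, ?_⟩
  · convert! (dp.mul de).mul d0 using 1
    simp only [decayingDeriv, Pi.mul_apply]
    ring
  · convert! (dp.mul de).mul ((di.mul d0).sub d1) using 1
    simp only [decayingDeriv, decaying, Pi.mul_apply, Pi.sub_apply]
    rw [← hlam]
    push_cast at hrec
    generalize laplaceIntegral (p - 1 / 2) c (p - 1 / 2) x = L₀ at *
    generalize laplaceIntegral (p - 1 / 2) c (p - 1 / 2 + 1) x = L₁ at *
    generalize laplaceIntegral (p - 1 / 2) c (p - 1 / 2 + 2) x = L₂ at *
    field_simp
    linear_combination (-((x ^ p : ℝ) : ℂ)) * x * hrec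

/-- `u(x) = (A + o(1)) e^{-cx} / √x` as `x → ∞`. -/
def HasDecay (c : ℂ) (u : ℝ → ℂ) (A : ℂ) : Prop :=
  Tendsto (fun x : ℝ => ((√x : ℝ) : ℂ) * Complex.exp (c * x) * u x) atTop (𝓝 A)

lemma HasDecay.const_mul {c : ℂ} {u : ℝ → ℂ} {A : ℂ} (h : HasDecay c u A) (t : ℂ) :
    HasDecay c (fun x => t * u x) (t * A) :=
  (Tendsto.const_mul t h).congr fun x => by ring

lemma HasDecay.congr {c : ℂ} {u v : ℝ → ℂ} {A : ℂ} (h : HasDecay c u A)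
    (huv : ∀ x : ℝ, 0 < x → v x = u x) : HasDecay c v A := by
  refine Tendsto.congr' ?_ h
  filter_upwards [eventually_gt_atTop 0] with x hx
  rw [huv x hx]

lemma tendsto_ofReal_div_atTop (z : ℂ) : Tendsto (fun x : ℝ => z / x) atTop (𝓝 0) := by
  have h := (Complex.continuous_ofReal.tendsto _).comp (tendsto_inv_atTop_zero (𝕜 := ℝ))
  have h2 := h.const_mul z
  rw [Complex.ofReal_zero, mul_zero] at h2
  refine h2.congr fun x => ?_
  simp [div_eq_mul_inv]

lemma sqrt_mul_rpow {p x : ℝ} (hx : 0 < x) : √x * x ^ p = x ^ (p - 1 / 2 + 1) := by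
  rw [Real.sqrt_eq_rpow, ← Real.rpow_add hx]
  congr 1
  ring

lemma exp_mul_exp_neg (c : ℂ) (x : ℝ) : Complex.exp (c * x) * Complex.exp (-(c * x)) = 1 := by
  rw [← Complex.exp_add]
  simp

lemma hasDecay_decaying {p : ℝ} (hp0 : 0 < p) (hp1 : p < 1) {c : ℂ} (hc : 0 ≤ c.re)
    (hc0 : c ≠ 0) :
    HasDecay c (decaying p c) ((2 * c) ^ ((p - 1 / 2 : ℝ) : ℂ) * Real.Gamma (p + 1 / 2)) := by
  have h := tendsto_laplaceIntegral_atTop (a := p - 1 / 2) (by linarith) hc hc0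
    (b := p - 1 / 2) (by linarith)
  rw [show Real.Gamma (p + 1 / 2) = Real.Gamma (p - 1 / 2 + 1) by congr 1; ring]
  refine h.congr' ?_
  filter_upwards [eventually_gt_atTop 0] with x hx
  rw [decaying, ← sqrt_mul_rpow hx]
  push_cast
  linear_combination (-(((√x : ℝ) : ℂ) * ((x ^ p : ℝ) : ℂ) *
    laplaceIntegral (p - 1 / 2) c (p - 1 / 2) x)) * exp_mul_exp_neg c x

lemma hasDecay_decayingDeriv {p : ℝ} (hp0 : 0 < p) (hp1 : p < 1) {c : ℂ} (hc : 0 ≤ c.re)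
    (hc0 : c ≠ 0) :
    HasDecay c (decayingDeriv p c)
      (-c * ((2 * c) ^ ((p - 1 / 2 : ℝ) : ℂ) * Real.Gamma (p + 1 / 2))) := by
  have h0 := tendsto_laplaceIntegral_atTop (a := p - 1 / 2) (by linarith) hc hc0
    (b := p - 1 / 2) (by linarith)
  have h1 := tendsto_laplaceIntegral_atTop (a := p - 1 / 2) (by linarith) hc hc0
    (b := p - 1 / 2 + 1) (by linarith)
  have h := (((tendsto_ofReal_div_atTop (p : ℂ)).sub_const c).mul h0).sub
    ((tendsto_ofReal_div_atTop 1).mul h1)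
  rw [zero_mul, sub_zero, zero_sub,
    show Real.Gamma (p - 1 / 2 + 1) = Real.Gamma (p + 1 / 2) by congr 1; ring] at h
  refine h.congr' ?_
  filter_upwards [eventually_gt_atTop 0] with x hx
  have hx' : (x : ℂ) ≠ 0 := Complex.ofReal_ne_zero.2 hx.ne'
  rw [decayingDeriv, Real.rpow_add_one hx.ne' (p - 1 / 2 + 1), ← sqrt_mul_rpow hx]
  push_cast
  generalize laplaceIntegral (p - 1 / 2) c (p - 1 / 2) x = L₀
  generalize laplaceIntegral (p - 1 / 2) c (p - 1 / 2 + 1) x = L₁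
  have he := exp_mul_exp_neg c x
  generalize Complex.exp (c * x) = E₁ at *
  generalize Complex.exp (-(c * x)) = E₂ at *
  field_simp
  linear_combination (-(((√x : ℝ) : ℂ) * ((x ^ p : ℝ) : ℂ) *
    ((p - c * x) * L₀ - x * L₁))) * he

lemma tendsto_rpow_mul_decaying {p : ℝ} (hp0 : 0 < p) (hp1 : p < 1) {c : ℂ} (hc : 0 ≤ c.re)
    (hc0 : c ≠ 0) :
    Tendsto (fun x : ℝ => ((x ^ p : ℝ) : ℂ) * decaying p c x) (𝓝[>] 0)
      (𝓝 (Real.Gamma (2 * p))) := by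
  have h := tendsto_laplaceIntegral_zero (a := p - 1 / 2) (by linarith) (by linarith) hc hc0
  have he : Tendsto (fun x : ℝ => Complex.exp (-(c * x))) (𝓝[>] 0) (𝓝 1) := by
    have : Continuous fun x : ℝ => Complex.exp (-(c * x)) := by fun_prop
    simpa using (this.tendsto 0).mono_left nhdsWithin_le_nhds
  have h2 := he.mul h
  rw [show 2 * (p - 1 / 2) + 1 = p + p by ring, one_mul, ← two_mul] at h2
  refine h2.congr' ?_
  filter_upwards [self_mem_nhdsWithin] with x hx
  rw [decaying, two_mul, Real.rpow_add hx]
  push_cast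
  ring

/-- A solution with the asymptotics `A e^{-cx}/√x` and `-cA e^{-cx}/√x` of its derivative is
unique for `A ≠ 0`: the Wronskian of two of them is `O(e^{-2cx})·o(1)`, hence zero. -/
lemma IsRadialSolution.eq_of_hasDecay {p lam : ℝ} (hp0 : 0 < p) (hp1 : p < 1) {c : ℂ}
    (hc : 0 ≤ c.re) {u u' v v' : ℝ → ℂ} (hu : IsRadialSolution p lam u u')
    (hv : IsRadialSolution p lam v v') {A : ℂ} (hA : A ≠ 0) (du : HasDecay c u A)
    (du' : HasDecay c u' (-c * A)) (dv : HasDecay c v A) (dv' : HasDecay c v' (-c * A)) :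
    ∀ x : ℝ, 0 < x → u x = v x := by
  obtain ⟨W, hW⟩ := hu.wronskian_const hv
  have hW0 : W = 0 := by
    have h1 : Tendsto (fun x : ℝ => (((√x : ℝ) : ℂ) * Complex.exp (c * x) * u x) *
        (((√x : ℝ) : ℂ) * Complex.exp (c * x) * v' x) -
        (((√x : ℝ) : ℂ) * Complex.exp (c * x) * u' x) *
        (((√x : ℝ) : ℂ) * Complex.exp (c * x) * v x)) atTop (𝓝 0) := by
      have := (Tendsto.mul du dv').sub (Tendsto.mul du' dv)
      rwa [show A * (-c * A) - -c * A * A = 0 by ring] at this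
    have h2 := h1.norm
    rw [norm_zero] at h2
    refine tendsto_nhds_unique (tendsto_const_nhds (x := W) (f := atTop (α := ℝ)))
      (squeeze_zero_norm' ?_ h2)
    filter_upwards [eventually_gt_atTop 0] with x hx
    have hs : ((√x : ℝ) : ℂ) * ((√x : ℝ) : ℂ) = x := by
      rw [← Complex.ofReal_mul, Real.mul_self_sqrt hx.le]
    have e : (((√x : ℝ) : ℂ) * Complex.exp (c * x) * u x) *
        (((√x : ℝ) : ℂ) * Complex.exp (c * x) * v' x) -
        (((√x : ℝ) : ℂ) * Complex.exp (c * x) * u' x) *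
        (((√x : ℝ) : ℂ) * Complex.exp (c * x) * v x) =
        Complex.exp (c * x) * Complex.exp (c * x) * W := by
      rw [← hW x hx, ← hs]
      ring
    rw [e, norm_mul, norm_mul, Complex.norm_exp]
    have hexp : 1 ≤ Real.exp ((c * x).re) := by
      rw [Real.one_le_exp_iff]
      simpa using mul_nonneg hc hx.le
    nlinarith [norm_nonneg W, mul_nonneg (sub_nonneg.2 hexp) (norm_nonneg W),
      mul_nonneg (mul_nonneg (sub_nonneg.2 hexp) (sub_nonneg.2 hexp)) (norm_nonneg W)]
  obtain ⟨a₁, b₁, h₁⟩ := hu.exists_frobenius hp0 hp1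
  obtain ⟨a₂, b₂, h₂⟩ := hv.exists_frobenius hp0 hp1
  have hdet : a₁ * b₂ = b₁ * a₂ := by
    have h := hW 1 one_pos
    have hp : (p : ℂ) ≠ 0 := Complex.ofReal_ne_zero.2 hp0.ne'
    have hw := wronskian_frobenius hp0 hp1 lam one_pos
    rw [hW0, (h₁ 1 one_pos).1, (h₁ 1 one_pos).2, (h₂ 1 one_pos).1, (h₂ 1 one_pos).2] at h
    have h3 : (-2 * (p : ℂ)) * (a₁ * b₂ - b₁ * a₂) = 0 := by
      rw [← hw]
      linear_combination h
    have h4 := (mul_eq_zero.1 h3).resolve_left (by simpa using hp)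
    linear_combination h4
  have key : ∃ t : ℂ, ∀ x : ℝ, 0 < x → u x = t * v x := by
    by_cases hb : b₂ = 0
    · have ha : a₂ ≠ 0 := by
        rintro rfl
        refine hA (tendsto_nhds_unique dv (tendsto_const_nhds.congr' ?_))
        filter_upwards [eventually_gt_atTop 0] with x hx
        rw [(h₂ x hx).1, hb]
        simp
      refine ⟨a₁ / a₂, fun x hx => ?_⟩
      rw [(h₁ x hx).1, (h₂ x hx).1]
      field_simp
      linear_combination (-(frobenius (-p) lam x : ℂ)) * hdet
    · refine ⟨b₁ / b₂, fun x hx => ?_⟩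
      rw [(h₁ x hx).1, (h₂ x hx).1]
      field_simp
      linear_combination (frobenius p lam x : ℂ) * hdet
  obtain ⟨t, ht⟩ := key
  have h3 := tendsto_nhds_unique du ((dv.const_mul t).congr ht)
  have ht1 : t = 1 := by
    have : (t - 1) * A = 0 := by linear_combination -h3
    exact sub_eq_zero.1 ((mul_eq_zero.1 this).resolve_right hA)
  intro x hx
  rw [ht x hx, ht1, one_mul]

/-- The operator `u ↦ u' + (p/r) u = r^{-p} (r^p u)'` lowers the order from `p` to `p - 1`. -/
lemma IsRadialSolution.lower {p lam : ℝ} {u u' : ℝ → ℂ} (hu : IsRadialSolution p lam u u') :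
    IsRadialSolution (1 - p) lam (fun r => u' r + p / r * u r)
      (fun r => ((p - 1) / r) * u' r + ((p ^ 2 - p) / r ^ 2 + lam) * u r) := by
  intro r hr
  have hr' : (r : ℂ) ≠ 0 := Complex.ofReal_ne_zero.2 hr.ne'
  have di (z : ℂ) : HasDerivAt (fun x : ℝ => z / (x : ℂ)) (-z / r ^ 2) r := by
    have h := (hasDerivAt_inv hr.ne').ofReal_comp.const_mul z
    convert! h using 1
    · ext y
      simp [div_eq_mul_inv]
    · push_cast
      field_simp
  have di2 (z : ℂ) : HasDerivAt (fun x : ℝ => z / (x : ℂ) ^ 2 + lam) (-2 * z / r ^ 3) r := by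
    have h := (((hasDerivAt_inv hr.ne').pow 2).ofReal_comp.const_mul z).add_const (lam : ℂ)
    convert! h using 1
    · ext y
      simp [div_eq_mul_inv]
    · push_cast
      field_simp
  refine ⟨?_, ?_⟩
  · convert! (hu r hr).2.add ((di p).mul (hu r hr).1) using 1
    field_simp
    ring
  · convert! ((di (p - 1)).mul (hu r hr).2).add ((di2 (p ^ 2 - p)).mul (hu r hr).1) using 1
    push_cast
    field_simp
    ring

lemma frobenius_lower {p : ℝ} (hp0 : 0 < p) (lam : ℝ) {r : ℝ} (hr : 0 < r) :
    frobeniusDeriv p lam r + p / r * frobenius p lam r =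
      2 * p * frobenius (-(1 - p)) lam r := by
  have h := besselEntire_contiguous (index_ne_of_gt (by linarith : -1 < p - 1)) (lam * r ^ 2 / 4)
  rw [show p - 1 + 1 = p by ring, show p - 1 + 2 = p + 1 by ring] at h
  rw [frobenius, frobenius, frobeniusDeriv, neg_sub, ← h, Real.rpow_sub_one hr.ne',
    show 1 + (p - 1) = p by ring, add_comm 1 p, Real.Gamma_add_one hp0.ne']
  field_simp
  ring

lemma frobenius_neg_lower {p : ℝ} (hp1 : p < 1) (lam : ℝ) {r : ℝ} (hr : 0 < r) :
    frobeniusDeriv (-p) lam r + p / r * frobenius (-p) lam r =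
      lam / (2 * (1 - p)) * frobenius (1 - p) lam r := by
  have h1 : 1 - p ≠ 0 := by linarith
  rw [frobenius, frobenius, frobeniusDeriv, add_comm 1 (1 - p), Real.Gamma_add_one h1,
    show (1 : ℝ) + -p = 1 - p by ring, show -p + 1 = 1 - p by ring,
    show r ^ (1 - p) = r ^ (-p) * r by
      rw [← Real.rpow_add_one hr.ne']; congr 1; ring]
  field_simp
  ring

/-- The coefficient `4^{-p} Γ(1-p) / Γ(1+p)` in the expansion of the decaying solution. -/
noncomputable def connectionCoeff (p : ℝ) : ℝ :=
  Real.Gamma (1 - p) / (4 ^ p * Real.Gamma (1 + p))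

lemma connectionCoeff_pos {p : ℝ} (hp0 : 0 < p) (hp1 : p < 1) : 0 < connectionCoeff p := by
  have h1 := Real.Gamma_pos_of_pos (by linarith : 0 < 1 - p)
  have h2 := Real.Gamma_pos_of_pos (by linarith : 0 < 1 + p)
  rw [connectionCoeff]
  positivity

/-- The connection coefficient in terms of the amplitudes of order `p` and `1 - p`, by the
duplication formula. -/
lemma connectionCoeff_eq {p : ℝ} (hp0 : 0 < p) (hp1 : p < 1) :
    connectionCoeff p = 2 ^ (2 * p - 1) * Real.Gamma (p + 1 / 2) * Real.Gamma (2 * (1 - p)) /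
      (Real.Gamma (1 - p + 1 / 2) * (2 * p) * Real.Gamma (2 * p)) := by
  have g1 := Real.Gamma_pos_of_pos hp0
  have g2 := Real.Gamma_pos_of_pos (by linarith : 0 < 1 - p)
  have g3 := Real.Gamma_pos_of_pos (by linarith : 0 < p + 1 / 2)
  have g4 := Real.Gamma_pos_of_pos (by linarith : 0 < 1 - p + 1 / 2)
  have g5 := Real.Gamma_pos_of_pos (by linarith : 0 < 2 * p)
  have g6 := Real.Gamma_pos_of_pos (by linarith : 0 < 2 * (1 - p))
  have d1 := Real.Gamma_mul_Gamma_add_half p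
  have d2 := Real.Gamma_mul_Gamma_add_half (1 - p)
  have hpi : 0 < √Real.pi := Real.sqrt_pos.2 Real.pi_pos
  set t : ℝ := 2 ^ p with ht
  have ht0 : 0 < t := by positivity
  have e1 : (2 : ℝ) ^ (2 * p - 1) = t * t / 2 := by
    rw [Real.rpow_sub_one two_ne_zero, two_mul, Real.rpow_add two_pos]
  have e2 : (2 : ℝ) ^ (1 - 2 * p) = 2 / (t * t) := by
    rw [Real.rpow_sub two_pos, Real.rpow_one, two_mul, Real.rpow_add two_pos]
  have e3 : (2 : ℝ) ^ (1 - 2 * (1 - p)) = t * t / 2 := by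
    rw [← e1]; congr 1; ring
  have e4 : (4 : ℝ) ^ p = t * t := by
    rw [ht, ← Real.mul_rpow (by norm_num) (by norm_num)]
    norm_num
  rw [e2] at d1
  rw [e3] at d2
  have f1 : Real.Gamma (p + 1 / 2) =
      Real.Gamma (2 * p) * (2 / (t * t)) * √Real.pi / Real.Gamma p := by
    rw [eq_div_iff g1.ne']; linarith
  have f2 : Real.Gamma (1 - p + 1 / 2) =
      Real.Gamma (2 * (1 - p)) * (t * t / 2) * √Real.pi / Real.Gamma (1 - p) := by
    rw [eq_div_iff g2.ne']; linarith
  rw [connectionCoeff, e1, e4, add_comm 1 p, Real.Gamma_add_one hp0.ne', f1, f2]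
  generalize Real.Gamma (2 * (1 - p)) = G at *
  field_simp

/-- The decaying solution in the Frobenius basis. The coefficient of the singular solution is its
leading term at the origin. The lowering operator turns the regular solution of order `p` into the
singular one of order `1 - p`, and the decaying solution into a multiple of the decaying one of
order `1 - p`, with the factor read off at infinity; so the other coefficient is again a leading
term at the origin. -/
lemma decaying_eq {p lam : ℝ} (hp0 : 0 < p) (hp1 : p < 1) {c : ℂ} (hc : 0 ≤ c.re)
    (hc0 : c ≠ 0) (hlam : c ^ 2 = lam) {x : ℝ} (hx : 0 < x) :
    decaying p c x = Real.Gamma (2 * p) * (frobenius (-p) lam x -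
      connectionCoeff p * c ^ ((2 * p : ℝ) : ℂ) * frobenius p lam x) := by
  have hq0 : 0 < 1 - p := by linarith
  have hq1 : 1 - p < 1 := by linarith
  have hpc : (p : ℂ) ≠ 0 := Complex.ofReal_ne_zero.2 hp0.ne'
  have sol := isRadialSolution_decaying hp0 hp1 hc hc0 hlam
  have solq := isRadialSolution_decaying hq0 hq1 hc hc0 hlam
  obtain ⟨a, b, hab⟩ := sol.exists_frobenius hp0 hp1
  have hbv := hasBoundaryValues_frobenius (j := p) (by rwa [abs_of_pos hp0])
    (by rwa [abs_of_pos hp0]) lam a b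
  rw [abs_of_pos hp0] at hbv
  have hb : b = Real.Gamma (2 * p) := by
    have h1 := (hbv.congr fun r hr => (hab r hr).1).1
    rw [abs_of_pos hp0] at h1
    exact tendsto_nhds_unique h1 (tendsto_rpow_mul_decaying hp0 hp1 hc hc0)
  -- amplitudes at infinity
  set A := (2 * c) ^ ((p - 1 / 2 : ℝ) : ℂ) * (Real.Gamma (p + 1 / 2) : ℂ) with hA
  set B := (2 * c) ^ ((1 - p - 1 / 2 : ℝ) : ℂ) * (Real.Gamma (1 - p + 1 / 2) : ℂ) with hB
  have h2c : 2 * c ≠ 0 := mul_ne_zero two_ne_zero hc0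
  have gA := Real.Gamma_pos_of_pos (by linarith : 0 < p + 1 / 2)
  have gB := Real.Gamma_pos_of_pos (by linarith : 0 < 1 - p + 1 / 2)
  have hA0 : A ≠ 0 := mul_ne_zero (by simp [Complex.cpow_eq_zero_iff, hc0])
    (Complex.ofReal_ne_zero.2 gA.ne')
  have hB0 : B ≠ 0 := mul_ne_zero (by simp [Complex.cpow_eq_zero_iff, hc0])
    (Complex.ofReal_ne_zero.2 gB.ne')
  have dA : HasDecay c (decaying p c) A := hasDecay_decaying hp0 hp1 hc hc0
  have dA' : HasDecay c (decayingDeriv p c) (-c * A) := hasDecay_decayingDeriv hp0 hp1 hc hc0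
  have dB : HasDecay c (decaying (1 - p) c) B := hasDecay_decaying hq0 hq1 hc hc0
  have dB' : HasDecay c (decayingDeriv (1 - p) c) (-c * B) := hasDecay_decayingDeriv hq0 hq1 hc hc0
  have dV : HasDecay c (fun r => decayingDeriv p c r + p / r * decaying p c r) (-c * A) := by
    have := Tendsto.add dA' ((tendsto_ofReal_div_atTop p).mul dA)
    rw [zero_mul, add_zero] at this
    exact this.congr fun x => by ring
  have dV' : HasDecay c (fun r => ((p - 1) / r) * decayingDeriv p c r +
      ((p ^ 2 - p) / r ^ 2 + lam) * decaying p c r) (-c * (-c * A)) := by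
    have h2 : Tendsto (fun x : ℝ => ((p : ℂ) ^ 2 - p) / (x : ℂ) ^ 2 + lam) atTop (𝓝 (lam : ℂ)) := by
      have := ((tendsto_ofReal_div_atTop ((p : ℂ) ^ 2 - p)).mul
        (tendsto_ofReal_div_atTop 1)).add_const (lam : ℂ)
      rw [zero_mul, zero_add] at this
      refine this.congr fun x => ?_
      rw [div_mul_div_comm, mul_one, pow_two (x : ℂ)]
    have := ((tendsto_ofReal_div_atTop ((p : ℂ) - 1)).mul dA').add (h2.mul dA)
    rw [zero_mul, zero_add, ← hlam, show c ^ 2 * A = -c * (-c * A) by ring] at this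
    rw [← hlam]
    exact this.congr fun x => by ring
  set K := -c * A / B with hK
  have hKB : K * B = -c * A := div_mul_cancel₀ _ hB0
  have solK := solq.linearCombination solq K 0
  have hV := sol.lower.eq_of_hasDecay hq0 hq1 hc solK (A := -c * A)
    (mul_ne_zero (neg_ne_zero.2 hc0) hA0) dV dV'
    (by simpa [hKB] using dB.const_mul K)
    (by
      have := dB'.const_mul K
      rw [show K * (-c * B) = -c * (K * B) by ring, hKB] at this
      simpa using this)
  have ha : 2 * p * a = K * Real.Gamma (2 * (1 - p)) := by
    have hbv' := hasBoundaryValues_frobenius (j := 1 - p) (by rwa [abs_of_pos hq0])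
      (by rwa [abs_of_pos hq0]) lam (b * (lam / (2 * (1 - p)))) (2 * p * a)
    rw [abs_of_pos hq0] at hbv'
    have h1 := (hbv'.congr (χ := fun r => K * decaying (1 - p) c r) fun r hr => by
      have e1 := frobenius_lower hp0 lam hr
      have e2 := frobenius_neg_lower hp1 lam hr
      have e := hV r hr
      simp only [zero_mul, add_zero] at e
      rw [← e, (hab r hr).1, (hab r hr).2]
      have c1 := congrArg (fun x : ℝ => (x : ℂ)) e1
      have c2 := congrArg (fun x : ℝ => (x : ℂ)) e2
      push_cast at c1 c2
      linear_combination a * c1 + b * c2).1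
    rw [abs_of_pos hq0] at h1
    refine tendsto_nhds_unique h1 ?_
    exact ((tendsto_rpow_mul_decaying hq0 hq1 hc hc0).const_mul K).congr fun x => by ring
  have haval : a = -(Real.Gamma (2 * p) * (connectionCoeff p * c ^ ((2 * p : ℝ) : ℂ))) := by
    have g5 := Real.Gamma_pos_of_pos (by linarith : 0 < 2 * p)
    have e0 : a = K * Real.Gamma (2 * (1 - p)) / (2 * p) := by
      rw [eq_div_iff (by simpa using hpc), ← ha]; ring
    have e1 : (2 * c) ^ ((p - 1 / 2 : ℝ) : ℂ) = (2 * c) ^ ((2 * p - 1 : ℝ) : ℂ) *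
        (2 * c) ^ ((1 - p - 1 / 2 : ℝ) : ℂ) := by
      rw [← Complex.cpow_add _ _ h2c]
      congr 1
      push_cast
      ring
    have e2 : (2 * c) ^ ((2 * p - 1 : ℝ) : ℂ) =
        ((2 ^ (2 * p - 1) : ℝ) : ℂ) * (c ^ ((2 * p : ℝ) : ℂ) / c) := by
      have := ofReal_mul_cpow two_pos hc0 ((2 * p - 1 : ℝ) : ℂ)
      rw [Complex.ofReal_ofNat] at this
      rw [this, Complex.ofReal_cpow zero_le_two]
      congr 1
      rw [Complex.ofReal_sub, Complex.ofReal_one, Complex.cpow_sub _ _ hc0, Complex.cpow_one]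
    have hC0 : (2 * c) ^ ((1 - p - 1 / 2 : ℝ) : ℂ) ≠ 0 := by
      simp [Complex.cpow_eq_zero_iff, hc0]
    have gB' := Complex.ofReal_ne_zero.2 gB.ne'
    have g5' := Complex.ofReal_ne_zero.2 g5.ne'
    rw [e0, hK, hA, hB, e1, e2, connectionCoeff_eq hp0 hp1]
    generalize (2 * c) ^ ((1 - p - 1 / 2 : ℝ) : ℂ) = C at *
    generalize c ^ ((2 * p : ℝ) : ℂ) = D at *
    generalize Real.Gamma (1 - p + 1 / 2) = G1 at *
    generalize Real.Gamma (2 * p) = G2 at *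
    generalize (2 : ℝ) ^ (2 * p - 1) = G3 at *
    push_cast
    field_simp
  rw [(hab x hx).1, hb, haval]
  ring

/-- The factor `Γ(p + 1/2) / Γ(2p)` in the amplitude at infinity of the decaying solution, when
normalized by the boundary value `c₀ = 1`. -/
noncomputable def amplitude (p : ℝ) : ℝ := Real.Gamma (p + 1 / 2) / Real.Gamma (2 * p)

lemma amplitude_pos {p : ℝ} (hp0 : 0 < p) : 0 < amplitude p :=
  div_pos (Real.Gamma_pos_of_pos (by linarith)) (Real.Gamma_pos_of_pos (by linarith))

/-- The combination of Frobenius solutions that behaves as `e^{-cx}/√x` at infinity, with its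
amplitude. For imaginary `c` this is the asymptotics of the Hankel functions. -/
theorem hasDecay_frobenius {p lam : ℝ} (hp0 : 0 < p) (hp1 : p < 1) {c : ℂ} (hc : 0 ≤ c.re)
    (hc0 : c ≠ 0) (hlam : c ^ 2 = lam) :
    HasDecay c (fun x => frobenius (-p) lam x -
      connectionCoeff p * c ^ ((2 * p : ℝ) : ℂ) * frobenius p lam x)
      ((2 * c) ^ ((p - 1 / 2 : ℝ) : ℂ) * amplitude p) := by
  have g : (Real.Gamma (2 * p) : ℂ) ≠ 0 :=
    Complex.ofReal_ne_zero.2 (Real.Gamma_pos_of_pos (by linarith)).ne'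
  have h := ((hasDecay_decaying hp0 hp1 hc hc0).const_mul (Real.Gamma (2 * p) : ℂ)⁻¹).congr
    (v := fun x => (frobenius (-p) lam x : ℂ) -
      connectionCoeff p * c ^ ((2 * p : ℝ) : ℂ) * frobenius p lam x) fun x hx => by
    rw [decaying_eq hp0 hp1 hc hc0 hlam hx, inv_mul_cancel_left₀ g]
  convert h using 1
  rw [amplitude]
  push_cast
  field_simp

/-! ### Weak solutions are classical solutions -/

lemma contDiffOn_one_Ioi {g g' : ℝ → ℂ} (hg : ∀ x : ℝ, 0 < x → HasDerivAt g (g' x) x)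
    (hg' : ContinuousOn g' (Set.Ioi 0)) : ContDiffOn ℝ 1 g (Set.Ioi 0) := by
  rw [show (1 : WithTop ℕ∞) = 0 + 1 from rfl, contDiffOn_succ_iff_deriv_of_isOpen isOpen_Ioi]
  refine ⟨fun x hx => (hg x hx).differentiableAt.differentiableWithinAt, by simp, ?_⟩
  rw [contDiffOn_zero]
  exact hg'.congr fun x hx => (hg x hx).deriv

lemma uIcc_subset_Ioi {a b : ℝ} (ha : 0 < a) (hab : a ≤ b) : Set.uIcc a b ⊆ Set.Ioi 0 := by
  rw [Set.uIcc_of_le hab]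
  exact fun x hx => ha.trans_le hx.1

/-- A locally absolutely continuous function whose derivative agrees almost everywhere with a
continuous function is continuously differentiable. -/
lemma hasDerivAt_of_absolutelyContinuous {f F : ℝ → ℂ}
    (hf : ∀ a b : ℝ, 0 < a → a < b → AbsolutelyContinuousOnInterval f a b)
    (hF : ContinuousOn F (Set.Ioi 0))
    (h : ∀ᵐ x, 0 < x → DifferentiableAt ℝ f x → deriv f x = F x) {r : ℝ} (hr : 0 < r) :
    HasDerivAt f (F r) r := by
  set G : ℝ → ℂ := fun x => ∫ t in r..x, F t with hG
  have hGd : ∀ x : ℝ, 0 < x → HasDerivAt G (F x) x := by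
    intro x hx
    refine intervalIntegral.integral_hasDerivAt_right ?_ ?_ (hF.continuousAt (Ioi_mem_nhds hx))
    · refine (hF.mono ?_).intervalIntegrable
      intro y hy
      exact lt_of_lt_of_le (lt_min hr hx) hy.1
    · exact hF.stronglyMeasurableAtFilter isOpen_Ioi x hx
  have hlt : r / 2 < 2 * r := by linarith
  have hsub := uIcc_subset_Ioi (half_pos hr) hlt.le
  have hac := hf _ _ (half_pos hr) hlt
  have hGac : AbsolutelyContinuousOnInterval G (r / 2) (2 * r) :=
    ((contDiffOn_one_Ioi hGd hF).mono hsub).absolutelyContinuousOnInterval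
  obtain ⟨C, hC⟩ := (hac.sub hGac).const_of_ae_hasDerivAt_zero (by
    filter_upwards [h, hac.boundedVariationOn.ae_differentiableAt_of_mem_uIcc] with x hx hd hmem
    have h1 := (hd hmem).hasDerivAt
    rw [hx (hsub hmem) (hd hmem)] at h1
    have := h1.sub (hGd x (hsub hmem))
    rwa [sub_self] at this)
  refine ((hGd r hr).const_add C).congr_of_eventuallyEq ?_
  have hn : Set.uIcc (r / 2) (2 * r) ∈ 𝓝 r := by
    rw [Set.uIcc_of_le hlt.le]
    exact Icc_mem_nhds (by linarith) (by linarith)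
  filter_upwards [hn] with x hx
  have := hC x hx
  simp only [Pi.sub_apply] at this
  rw [← this]
  ring

lemma LocallyRegular.isRadialSolution {j Λ : ℝ} {ψ : ℝ → ℂ} (h : LocallyRegular ψ)
    (heq : ∀ᵐ r ∂volume.restrict (Set.Ioi (0 : ℝ)), radialH j ψ r = (Λ : ℂ) * ψ r) :
    IsRadialSolution |j| (-Λ) ψ (deriv ψ) := by
  have hψ : ContinuousOn ψ (Set.Ioi 0) :=
    fun x hx => (h.1 x hx).continuousAt.continuousWithinAt
  have hψ' : ContinuousOn (deriv ψ) (Set.Ioi 0) := by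
    intro x hx
    have hx0 : (0 : ℝ) < x := hx
    have hlt : x / 2 < 2 * x := by linarith
    refine ((h.2 (x / 2) (2 * x) (half_pos hx) hlt).continuousOn.continuousAt
      ?_).continuousWithinAt
    rw [Set.uIcc_of_le hlt.le]
    exact Icc_mem_nhds (by linarith) (by linarith)
  have hinv : ContinuousOn (fun r : ℝ => (r : ℂ)⁻¹) (Set.Ioi 0) :=
    Complex.continuous_ofReal.continuousOn.inv₀ fun r hr => Complex.ofReal_ne_zero.2 (ne_of_gt hr)
  intro r hr
  refine ⟨(h.1 r hr).hasDerivAt, ?_⟩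
  refine hasDerivAt_of_absolutelyContinuous (F := fun r => -(1 / (r : ℂ)) * deriv ψ r +
    (((|j| : ℝ) : ℂ) ^ 2 / (r : ℂ) ^ 2 + (-Λ : ℝ)) * ψ r) h.2 ?_ ?_ hr
  · simp only [div_eq_mul_inv, one_mul, ← inv_pow]
    fun_prop
  · rw [ae_restrict_iff' measurableSet_Ioi] at heq
    filter_upwards [heq] with x hx hx0 _
    have := hx hx0
    rw [radialH] at this
    have hj : ((|j| : ℝ) : ℂ) ^ 2 = (j : ℂ) ^ 2 := by
      rw [← Complex.ofReal_pow, sq_abs, Complex.ofReal_pow]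
    rw [hj]
    push_cast
    linear_combination -this

lemma IsRadialSolution.deriv_eq {p lam : ℝ} {u u' : ℝ → ℂ} (hu : IsRadialSolution p lam u u')
    {r : ℝ} (hr : 0 < r) : deriv u r = u' r := (hu r hr).1.deriv

lemma IsRadialSolution.hasDerivAt_deriv {p lam : ℝ} {u u' : ℝ → ℂ}
    (hu : IsRadialSolution p lam u u') {r : ℝ} (hr : 0 < r) :
    HasDerivAt (deriv u) (-(1 / (r : ℂ)) * u' r + ((p : ℂ) ^ 2 / (r : ℂ) ^ 2 + lam) * u r) r := by
  refine (hu r hr).2.congr_of_eventuallyEq ?_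
  filter_upwards [Ioi_mem_nhds hr] with x hx
  exact hu.deriv_eq hx

lemma IsRadialSolution.locallyRegular {p lam : ℝ} {u u' : ℝ → ℂ}
    (hu : IsRadialSolution p lam u u') : LocallyRegular u := by
  refine ⟨fun r hr => (hu r hr).1.differentiableAt, fun a b ha hab => ?_⟩
  refine ((contDiffOn_one_Ioi (fun x hx => hu.hasDerivAt_deriv hx) ?_).mono
    (uIcc_subset_Ioi ha hab.le)).absolutelyContinuousOnInterval
  have h1 : ContinuousOn u (Set.Ioi 0) := fun x hx => (hu x hx).1.continuousAt.continuousWithinAt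
  have h2 : ContinuousOn u' (Set.Ioi 0) := fun x hx => (hu x hx).2.continuousAt.continuousWithinAt
  have hinv : ContinuousOn (fun r : ℝ => (r : ℂ)⁻¹) (Set.Ioi 0) :=
    Complex.continuous_ofReal.continuousOn.inv₀ fun r hr => Complex.ofReal_ne_zero.2 (ne_of_gt hr)
  simp only [div_eq_mul_inv, one_mul, ← inv_pow]
  fun_prop

lemma IsRadialSolution.radialH_eq {j Λ : ℝ} {u u' : ℝ → ℂ}
    (hu : IsRadialSolution |j| (-Λ) u u') {r : ℝ} (hr : 0 < r) :
    radialH j u r = (Λ : ℂ) * u r := by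
  rw [radialH, (hu.hasDerivAt_deriv hr).deriv, hu.deriv_eq hr, ← Complex.ofReal_pow |j|, sq_abs]
  push_cast
  ring

/-! ### Solutions that satisfy the boundary condition -/

/-- The boundary value `c₁` of the distinguished solution: `1` for `ν = ∞`, and `ν` otherwise. -/
noncomputable def regularWeight : WithTop ℝ → ℝ
  | ⊤ => 1
  | (v : ℝ) => v

/-- The boundary value `c₀` of the distinguished solution: `0` for `ν = ∞`, and `1` otherwise. -/
noncomputable def singularWeight : WithTop ℝ → ℝ
  | ⊤ => 0
  | (_ : ℝ) => 1

@[simp] lemma regularWeight_top : regularWeight ⊤ = 1 := rfl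

@[simp] lemma regularWeight_coe (v : ℝ) : regularWeight v = v := rfl

@[simp] lemma singularWeight_top : singularWeight ⊤ = 0 := rfl

@[simp] lemma singularWeight_coe (v : ℝ) : singularWeight v = 1 := rfl

/-- The solution with boundary values `c₀ = singularWeight ν` and `c₁ = regularWeight ν`. -/
noncomputable def boundarySolution (p : ℝ) (ν : WithTop ℝ) (lam r : ℝ) : ℝ :=
  regularWeight ν * frobenius p lam r + singularWeight ν * frobenius (-p) lam r

lemma boundaryCondition_iff {j : ℝ} {ν : WithTop ℝ} {ψ : ℝ → ℂ} {c₀ c₁ : ℂ}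
    (h : HasBoundaryValues j ψ c₀ c₁) :
    BoundaryCondition j ν ψ ↔ ∃ t : ℂ, c₀ = t * singularWeight ν ∧ c₁ = t * regularWeight ν := by
  constructor
  · rintro ⟨d₀, d₁, hd, htop, hfin⟩
    obtain ⟨rfl, rfl⟩ := h.unique hd
    induction ν with
    | top => exact ⟨c₁, by simp [htop rfl], by simp⟩
    | coe v => exact ⟨c₀, by simp, by rw [← hfin v rfl, regularWeight_coe, mul_comm]⟩
  · rintro ⟨t, h0, h1⟩
    refine ⟨c₀, c₁, h, ?_, ?_⟩
    · rintro rfl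
      simp [h0]
    · rintro v rfl
      rw [h0, h1]
      simp [mul_comm]

lemma isRadialSolution_congr {p lam : ℝ} {u v u' : ℝ → ℂ} (hu : IsRadialSolution p lam u u')
    (h : ∀ r : ℝ, 0 < r → v r = u r) : IsRadialSolution p lam v u' := by
  intro r hr
  refine ⟨(hu r hr).1.congr_of_eventuallyEq ?_, ?_⟩
  · filter_upwards [Ioi_mem_nhds hr] with x hx
    exact h x hx
  · rw [h r hr]
    exact (hu r hr).2

lemma isRadialSolution_boundarySolution {p : ℝ} (hp0 : 0 < p) (hp1 : p < 1) (ν : WithTop ℝ)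
    (lam : ℝ) : ∃ u' : ℝ → ℂ,
      IsRadialSolution p lam (fun r => (boundarySolution p ν lam r : ℂ)) u' := by
  have h := (isRadialSolution_frobenius (index_ne_of_gt (by linarith : -1 < p)) rfl
    lam).linearCombination (isRadialSolution_frobenius (index_ne_of_gt (by linarith : -1 < -p))
    (neg_sq p) lam) (regularWeight ν) (singularWeight ν)
  exact ⟨_, isRadialSolution_congr h fun r _ => by simp [boundarySolution]⟩

lemma exists_boundarySolution_ne_zero {j : ℝ} (hj0 : 0 < |j|) (hj1 : |j| < 1) (ν : WithTop ℝ)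
    (lam : ℝ) : ∃ r : ℝ, 0 < r ∧ boundarySolution |j| ν lam r ≠ 0 := by
  by_contra! h
  have hbv := hasBoundaryValues_frobenius hj0 hj1 lam (regularWeight ν) (singularWeight ν)
  have h0 : HasBoundaryValues j (fun _ => 0) 0 0 := by
    constructor <;> simp
  have := hbv.unique (h0.congr (χ := fun r => (regularWeight ν : ℂ) * frobenius |j| lam r +
    singularWeight ν * frobenius (-|j|) lam r) fun r hr => by
      rw [← Complex.ofReal_zero, ← h r hr, boundarySolution]
      push_cast
      rfl)
  induction ν with
  | top => simpa using this.2
  | coe v => simpa using this.1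

/-- The nonzero solutions of `h₀ ψ = Λ ψ` with the boundary condition `ν` are the nonzero multiples
of `boundarySolution`. -/
theorem solution_iff {j : ℝ} (hj0 : 0 < |j|) (hj1 : |j| < 1) (ν : WithTop ℝ) (Λ : ℝ) (ψ : ℝ → ℂ) :
    (LocallyRegular ψ ∧ BoundaryCondition j ν ψ ∧
      (∀ᵐ r ∂volume.restrict (Set.Ioi (0 : ℝ)), radialH j ψ r = (Λ : ℂ) * ψ r) ∧
      ∃ r : ℝ, 0 < r ∧ ψ r ≠ 0) ↔
    ∃ t : ℂ, t ≠ 0 ∧ ∀ r : ℝ, 0 < r → ψ r = t * boundarySolution |j| ν (-Λ) r := by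
  constructor
  · rintro ⟨hreg, hbc, heq, r, hr, hne⟩
    obtain ⟨a, b, hab⟩ := (hreg.isRadialSolution heq).exists_frobenius hj0 hj1
    have hbv := (hasBoundaryValues_frobenius hj0 hj1 (-Λ) a b).congr fun r hr => (hab r hr).1
    obtain ⟨t, rfl, rfl⟩ := (boundaryCondition_iff hbv).1 hbc
    have key : ∀ r : ℝ, 0 < r → ψ r = t * boundarySolution |j| ν (-Λ) r := by
      intro r hr
      rw [(hab r hr).1, boundarySolution]
      push_cast
      ring
    refine ⟨t, ?_, key⟩
    rintro rfl
    exact hne (by rw [key r hr, zero_mul])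
  · rintro ⟨t, ht, h⟩
    obtain ⟨u', hu'⟩ := isRadialSolution_boundarySolution hj0 hj1 ν (-Λ)
    have hs := isRadialSolution_congr (v := ψ) (hu'.linearCombination hu' t 0) fun r hr => by
      rw [h r hr]; ring
    have hbv := (hasBoundaryValues_frobenius hj0 hj1 (-Λ) (t * regularWeight ν)
      (t * singularWeight ν)).congr (χ := ψ) fun r hr => by
        rw [h r hr, boundarySolution]
        push_cast
        ring
    refine ⟨hs.locallyRegular, (boundaryCondition_iff hbv).2 ⟨t, rfl, rfl⟩, ?_, ?_⟩
    · filter_upwards [ae_restrict_mem measurableSet_Ioi] with r hr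
      exact hs.radialH_eq hr
    · obtain ⟨r, hr, hne⟩ := exists_boundarySolution_ne_zero hj0 hj1 ν (-Λ)
      exact ⟨r, hr, by rw [h r hr]; exact mul_ne_zero ht (Complex.ofReal_ne_zero.2 hne)⟩

lemma isGeneralizedEigenfunction_iff {j : ℝ} (hj0 : 0 < |j|) (hj1 : |j| < 1) (ν : WithTop ℝ)
    (k : ℝ) (ψ : ℝ → ℂ) : IsGeneralizedEigenfunction j ν k ψ ↔
      ∃ t : ℂ, t ≠ 0 ∧ ∀ r : ℝ, 0 < r → ψ r = t * boundarySolution |j| ν (-k ^ 2) r :=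
  solution_iff hj0 hj1 ν (k ^ 2) ψ

/-! ### Scattering -/

lemma I_cpow (w : ℂ) : Complex.I ^ w = Complex.exp (Real.pi / 2 * w * Complex.I) := by
  rw [Complex.cpow_def_of_ne_zero Complex.I_ne_zero, Complex.log_I]
  congr 1
  ring

lemma neg_I_cpow (w : ℂ) : (-Complex.I) ^ w = Complex.exp (-(Real.pi / 2 * w * Complex.I)) := by
  rw [Complex.cpow_def_of_ne_zero (neg_ne_zero.2 Complex.I_ne_zero), Complex.log_neg_I]
  congr 1
  ring

lemma norm_exp_I_mul_ofReal (x : ℝ) : ‖Complex.exp (Complex.I * x)‖ = 1 := by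
  rw [mul_comm, Complex.norm_exp_ofReal_mul_I]

/-- For imaginary `c`, `u ~ A e^{-cx}/√x` in the additive form. -/
lemma HasDecay.tendsto_sub {c : ℂ} (hc : c.re = 0) {u : ℝ → ℂ} {A : ℂ} (h : HasDecay c u A) :
    Tendsto (fun x : ℝ => ((√x : ℝ) : ℂ) * u x - A * Complex.exp (-(c * x))) atTop (𝓝 0) := by
  have h1 := (tendsto_sub_nhds_zero_iff.2 h).norm
  rw [norm_zero] at h1
  refine squeeze_zero_norm (fun x => ?_) h1
  have e : ((√x : ℝ) : ℂ) * Complex.exp (c * x) * u x - A =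
      Complex.exp (c * x) * (((√x : ℝ) : ℂ) * u x - A * Complex.exp (-(c * x))) := by
    linear_combination A * exp_mul_exp_neg c x
  rw [e, norm_mul, Complex.norm_exp]
  simp [hc]

/-- The incoming and outgoing waves are linearly independent modulo `o(1)`: a quarter period
turns `e^{2iθ}` into its negative. -/
lemma eq_zero_of_tendsto_waves {k : ℝ} (hk : 0 < k) (m : ℤ) {A B : ℂ}
    (h : Tendsto (fun r : ℝ => A * Complex.exp (-(Complex.I * (freePhase m k r : ℂ))) +
      B * Complex.exp (Complex.I * (freePhase m k r : ℂ))) atTop (𝓝 0)) : A = 0 ∧ B = 0 := by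
  have h1 : Tendsto (fun r : ℝ => A + B * Complex.exp (2 * Complex.I * (freePhase m k r : ℂ)))
      atTop (𝓝 0) := by
    have hn := h.norm
    rw [norm_zero] at hn
    refine squeeze_zero_norm (fun r => le_of_eq ?_) hn
    have e : A + B * Complex.exp (2 * Complex.I * (freePhase m k r : ℂ)) =
        Complex.exp (Complex.I * (freePhase m k r : ℂ)) *
        (A * Complex.exp (-(Complex.I * (freePhase m k r : ℂ))) +
          B * Complex.exp (Complex.I * (freePhase m k r : ℂ))) := by
      have e1 : Complex.exp (2 * Complex.I * (freePhase m k r : ℂ)) =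
          Complex.exp (Complex.I * (freePhase m k r : ℂ)) *
          Complex.exp (Complex.I * (freePhase m k r : ℂ)) := by
        rw [← Complex.exp_add]; ring_nf
      have e2 := exp_mul_exp_neg Complex.I (freePhase m k r)
      rw [e1]
      linear_combination -A * e2
    rw [e, norm_mul, norm_exp_I_mul_ofReal, one_mul]
  have hshift : Tendsto (fun r : ℝ => r + Real.pi / (2 * k)) atTop atTop :=
    tendsto_atTop_add_const_right _ _ tendsto_id
  have h2 := h1.comp hshift
  have h3 : Tendsto (fun r : ℝ => A - B * Complex.exp (2 * Complex.I * (freePhase m k r : ℂ)))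
      atTop (𝓝 0) := by
    refine h2.congr fun r => ?_
    simp only [Function.comp]
    have e : freePhase m k (r + Real.pi / (2 * k)) = freePhase m k r + Real.pi / 2 := by
      rw [freePhase, freePhase]
      field_simp
      ring
    rw [e]
    have e1 : 2 * Complex.I * ((freePhase m k r + Real.pi / 2 : ℝ) : ℂ) =
        2 * Complex.I * (freePhase m k r : ℂ) + Real.pi * Complex.I := by
      push_cast; ring
    rw [e1, Complex.exp_add, Complex.exp_pi_mul_I]
    ring
  have hA : A = 0 := by
    have h4 := h1.add h3
    rw [add_zero] at h4
    have h5 := tendsto_nhds_unique h4 (tendsto_const_nhds (x := 2 * A) |>.congr fun r => by ring)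
    simpa using h5.symm
  refine ⟨hA, ?_⟩
  have h6 := h1.norm
  subst hA
  simp only [zero_add, norm_mul, norm_zero] at h6
  have h7 := tendsto_nhds_unique h6 (tendsto_const_nhds (x := ‖B‖) |>.congr fun r => by
    rw [show (2 : ℂ) * Complex.I * (freePhase m k r : ℂ) =
      Complex.I * ((2 * freePhase m k r : ℝ) : ℂ) by push_cast; ring, norm_exp_I_mul_ofReal,
      mul_one])
  exact norm_eq_zero.1 h7.symm

/-- `c₁ + T c₀ e^{iπps}` with `T = 4^{-p} k^{2p} Γ(1-p)/Γ(1+p)`, where `c₀`, `c₁` are the boundary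
values of `boundarySolution p ν`. Written in the two solutions that `hasDecay_frobenius` gives for
`c = -ik` (outgoing) and `c = ik` (incoming), `boundarySolution p ν` has, up to a common factor, the
coefficients `jostFactor p k ν 1` and `-jostFactor p k ν (-1)`. -/
noncomputable def jostFactor (p k : ℝ) (ν : WithTop ℝ) (s : ℂ) : ℂ :=
  regularWeight ν + (connectionCoeff p * k ^ (2 * p) : ℝ) * singularWeight ν *
    Complex.exp (s * (Complex.I * Real.pi * p))

lemma exp_eq_cos_add_sin (x : ℝ) : Complex.exp (1 * (Complex.I * Real.pi * x)) =
    Real.cos (x * Real.pi) + Real.sin (x * Real.pi) * Complex.I := by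
  rw [Complex.ofReal_cos, Complex.ofReal_sin, ← Complex.exp_mul_I]
  push_cast
  congr 1
  ring

lemma exp_neg_eq_cos_sub_sin (x : ℝ) : Complex.exp (-1 * (Complex.I * Real.pi * x)) =
    Real.cos (x * Real.pi) - Real.sin (x * Real.pi) * Complex.I := by
  rw [Complex.ofReal_cos, Complex.ofReal_sin, Complex.cos_sub_sin_I]
  push_cast
  congr 1
  ring

lemma sin_mul_pi_pos {p : ℝ} (hp0 : 0 < p) (hp1 : p < 1) : 0 < Real.sin (p * Real.pi) :=
  Real.sin_pos_of_pos_of_lt_pi (mul_pos hp0 Real.pi_pos)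
    (by nlinarith [Real.pi_pos])

lemma jostFactor_ne_zero {p k : ℝ} (hp0 : 0 < p) (hp1 : p < 1) (hk : 0 < k) (ν : WithTop ℝ) :
    jostFactor p k ν (-1) ≠ 0 := by
  intro h
  have hT : 0 < connectionCoeff p * k ^ (2 * p) :=
    mul_pos (connectionCoeff_pos hp0 hp1) (Real.rpow_pos_of_pos hk _)
  have hs := sin_mul_pi_pos hp0 hp1
  rw [jostFactor, exp_neg_eq_cos_sub_sin] at h
  induction ν with
  | top => simp at h
  | coe v =>
    have := congrArg Complex.im h
    simp [-Complex.ofReal_mul] at this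
    rcases this with h | h
    · exact hT.ne' (mul_eq_zero.2 h)
    · exact hs.ne' h

/-- Asymptotics of `boundarySolution` at infinity: it is a combination of the two solutions that
`hasDecay_frobenius` gives for `c = -ik` and `c = ik`, each of them a single wave. -/
theorem exists_tendsto_boundarySolution {j : ℝ} (hj0 : 0 < |j|) (hj1 : |j| < 1) (ν : WithTop ℝ)
    (m : ℤ) {k : ℝ} (hk : 0 < k) :
    ∃ C : ℂ, C ≠ 0 ∧ Tendsto (fun r : ℝ => ((√r : ℝ) : ℂ) * boundarySolution |j| ν (-k ^ 2) r -
      C * (Complex.exp (-(Complex.I * (freePhase m k r : ℂ))) +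
        Complex.exp (2 * Complex.I * (phaseShiftAB j m : ℂ)) *
          (jostFactor |j| k ν 1 / jostFactor |j| k ν (-1)) *
        Complex.exp (Complex.I * (freePhase m k r : ℂ)))) atTop (𝓝 0) := by
  set p := |j| with hp
  have hkc : (k : ℂ) ≠ 0 := Complex.ofReal_ne_zero.2 hk.ne'
  have hI := Complex.I_ne_zero
  have hout := (hasDecay_frobenius (lam := -k ^ 2) hj0 hj1 (c := k * -Complex.I) (by simp)
    (mul_ne_zero hkc (neg_ne_zero.2 hI))
    (by push_cast; rw [mul_pow, neg_sq, Complex.I_sq]; ring)).tendsto_sub (by simp)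
  have hin := (hasDecay_frobenius (lam := -k ^ 2) hj0 hj1 (c := k * Complex.I) (by simp)
    (mul_ne_zero hkc hI) (by push_cast; rw [mul_pow, Complex.I_sq]; ring)).tendsto_sub (by simp)
  have pow_out (w : ℂ) := ofReal_mul_cpow hk (neg_ne_zero.2 hI) w
  have pow_in (w : ℂ) := ofReal_mul_cpow hk hI w
  have amp_out (w : ℂ) : (2 * (k * -Complex.I)) ^ w =
      ((2 * k : ℝ) : ℂ) ^ w * Complex.exp (-(Real.pi / 2 * w * Complex.I)) := by
    rw [← neg_I_cpow, ← ofReal_mul_cpow (by positivity) (neg_ne_zero.2 hI)]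
    push_cast
    ring_nf
  have amp_in (w : ℂ) : (2 * (k * Complex.I)) ^ w =
      ((2 * k : ℝ) : ℂ) ^ w * Complex.exp (Real.pi / 2 * w * Complex.I) := by
    rw [← I_cpow, ← ofReal_mul_cpow (by positivity) hI]
    push_cast
    ring_nf
  simp only [neg_I_cpow] at pow_out
  simp only [I_cpow] at pow_in
  simp only [pow_out, amp_out] at hout
  simp only [pow_in, amp_in] at hin
  set T : ℝ := connectionCoeff p * k ^ (2 * p) with hT
  have hT0 : 0 < T := mul_pos (connectionCoeff_pos hj0 hj1) (Real.rpow_pos_of_pos hk _)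
  have hTc : (T : ℂ) ≠ 0 := Complex.ofReal_ne_zero.2 hT0.ne'
  set H : ℂ := ((2 * k : ℝ) : ℂ) ^ ((p - 1 / 2 : ℝ) : ℂ) * amplitude p with hH
  have hH0 : H ≠ 0 := by
    refine mul_ne_zero ?_ (Complex.ofReal_ne_zero.2 (amplitude_pos hj0).ne')
    rw [Ne, Complex.cpow_eq_zero_iff]
    simp [hk.ne']
  set P := jostFactor p k ν 1 with hP
  set Q := jostFactor p k ν (-1) with hQ
  have hQ0 : Q ≠ 0 := jostFactor_ne_zero hj0 hj1 hk ν
  set E := Complex.exp (1 * (Complex.I * Real.pi * p)) with hE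
  set E' := Complex.exp (-1 * (Complex.I * Real.pi * p)) with hE'
  have hD : E - E' ≠ 0 := by
    rw [hE, hE', exp_eq_cos_add_sin, exp_neg_eq_cos_sub_sin]
    ring_nf
    have := sin_mul_pi_pos hj0 hj1
    simp [mul_comm] at this ⊢
    exact_mod_cast this.ne'
  have hP' : P = regularWeight ν + T * singularWeight ν * E := rfl
  have hQ' : Q = regularWeight ν + T * singularWeight ν * E' := rfl
  -- half phases
  set F := Complex.exp (Real.pi / 2 * ((p - 1 / 2 : ℝ) : ℂ) * Complex.I) with hF
  set η : ℂ := Complex.I * (|(m : ℝ)| * Real.pi / 2 + Real.pi / 4 : ℝ) with hη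
  have hlim := (hout.const_mul (P / (T * (E - E')))).add (hin.const_mul (-Q / (T * (E - E'))))
  rw [mul_zero, mul_zero, add_zero] at hlim
  refine ⟨-Q / (T * (E - E')) * H * F * Complex.exp (-η), ?_, ?_⟩
  · have h1 : -Q / (T * (E - E')) ≠ 0 := div_ne_zero (neg_ne_zero.2 hQ0) (mul_ne_zero hTc hD)
    exact mul_ne_zero (mul_ne_zero (mul_ne_zero h1 hH0) (Complex.exp_ne_zero _))
      (Complex.exp_ne_zero _)
  · refine hlim.congr fun r => ?_
    have ek : (k : ℂ) ^ ((2 * p : ℝ) : ℂ) = ((k ^ (2 * p) : ℝ) : ℂ) :=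
      (Complex.ofReal_cpow hk.le _).symm
    have e1 : Complex.exp (-(Real.pi / 2 * ((2 * p : ℝ) : ℂ) * Complex.I)) = E' := by
      rw [hE']; congr 1; push_cast; ring
    have e2 : Complex.exp (Real.pi / 2 * ((2 * p : ℝ) : ℂ) * Complex.I) = E := by
      rw [hE]; congr 1; push_cast; ring
    have e3 : Complex.exp (-(k * -Complex.I * r)) =
        Complex.exp (Complex.I * (freePhase m k r : ℂ)) * Complex.exp η := by
      rw [hη, freePhase, ← Complex.exp_add]; congr 1; push_cast; ring
    have e4 : Complex.exp (-(k * Complex.I * r)) =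
        Complex.exp (-(Complex.I * (freePhase m k r : ℂ))) * Complex.exp (-η) := by
      rw [hη, freePhase, ← Complex.exp_add]; congr 1; push_cast; ring
    -- `e^{2iδ_m} F e^{-η} = - F⁻¹ e^{η}`
    have e5 : Complex.exp (2 * Complex.I * (phaseShiftAB j m : ℂ)) * F * Complex.exp (-η) =
        -(Complex.exp (-(Real.pi / 2 * ((p - 1 / 2 : ℝ) : ℂ) * Complex.I)) * Complex.exp η) := by
      have harg : 2 * Complex.I * (phaseShiftAB j m : ℂ) +
          Real.pi / 2 * ((p - 1 / 2 : ℝ) : ℂ) * Complex.I + -η =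
          -(Real.pi / 2 * ((p - 1 / 2 : ℝ) : ℂ) * Complex.I) + η - Real.pi * Complex.I := by
        rw [hη, phaseShiftAB, ← hp]
        push_cast
        ring
      rw [hF, ← Complex.exp_add, ← Complex.exp_add, ← Complex.exp_add, harg, Complex.exp_sub,
        Complex.exp_pi_mul_I, div_neg, div_one]
    rw [ek, e1, e2, e3, e4, boundarySolution]
    generalize Complex.exp (-(Real.pi / 2 * ((p - 1 / 2 : ℝ) : ℂ) * Complex.I)) = F' at *
    generalize Complex.exp (2 * Complex.I * (phaseShiftAB j m : ℂ)) = Z at *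
    generalize Complex.exp (Complex.I * (freePhase m k r : ℂ)) = U at *
    generalize Complex.exp (-(Complex.I * (freePhase m k r : ℂ))) = V at *
    generalize Complex.exp η = N at *
    generalize Complex.exp (-η) = N' at *
    generalize ((2 * k : ℝ) : ℂ) ^ ((p - 1 / 2 : ℝ) : ℂ) = X at *
    have hTT : (connectionCoeff p : ℂ) * ((k ^ (2 * p) : ℝ) : ℂ) = T := by
      rw [hT]; push_cast; rfl
    push_cast
    rw [← mul_assoc (connectionCoeff p : ℂ), ← mul_assoc (connectionCoeff p : ℂ), hTT]
    have s1 : P / (T * (E - E')) + -Q / (T * (E - E')) = singularWeight ν := by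
      rw [hP', hQ']; field_simp; ring
    have s2 : P / (T * (E - E')) * (-(T * E')) + -Q / (T * (E - E')) * (-(T * E)) =
        regularWeight ν := by
      rw [hP', hQ']; field_simp; ring
    rw [← s1, ← s2]
    have e6 : -Q / (T * (E - E')) * H * F * N' * (V + Z * (P / Q) * U) =
        -Q / (T * (E - E')) * H * F * N' * V + P / (T * (E - E')) * H * F' * N * U := by
      have : -Q / (T * (E - E')) * H * F * N' * (V + Z * (P / Q) * U) =
        -Q / (T * (E - E')) * H * F * N' * V - P / (T * (E - E')) * H * (Z * F * N') * U := by
        field_simp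
        ring
      rw [this, e5]
      ring
    rw [e6, hH]
    ring

theorem isSMatrixElement_iff {j : ℝ} (hj0 : 0 < |j|) (hj1 : |j| < 1) (ν : WithTop ℝ) (m : ℤ)
    {k : ℝ} (hk : 0 < k) (S : ℂ) :
    IsSMatrixElement j ν m k S ↔ S = Complex.exp (2 * Complex.I * (phaseShiftAB j m : ℂ)) *
      (jostFactor |j| k ν 1 / jostFactor |j| k ν (-1)) := by
  obtain ⟨C₀, hC₀, h₀⟩ := exists_tendsto_boundarySolution hj0 hj1 ν m hk
  set S₀ := Complex.exp (2 * Complex.I * (phaseShiftAB j m : ℂ)) *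
    (jostFactor |j| k ν 1 / jostFactor |j| k ν (-1)) with hS₀
  constructor
  · rintro ⟨ψ, hψ, C, hC, h⟩
    obtain ⟨t, ht, hψt⟩ := (isGeneralizedEigenfunction_iff hj0 hj1 ν k ψ).1 hψ
    have h1 := (h₀.const_mul t).sub h
    rw [mul_zero, sub_zero] at h1
    have h2 := eq_zero_of_tendsto_waves hk m (A := C - t * C₀) (B := C * S - t * C₀ * S₀) (by
      refine h1.congr' ?_
      filter_upwards [eventually_gt_atTop 0] with r hr
      rw [hψt r hr]
      ring)
    have h3 : C * (S - S₀) = 0 := by linear_combination h2.2 - S₀ * h2.1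
    exact sub_eq_zero.1 ((mul_eq_zero.1 h3).resolve_left hC)
  · rintro rfl
    exact ⟨_, (isGeneralizedEigenfunction_iff hj0 hj1 ν k _).2
      ⟨1, one_ne_zero, fun r _ => (one_mul _).symm⟩, C₀, hC₀, h₀⟩

/-- `cos (θ + δ)` is a multiple of `e^{-iθ} + e^{2iδ} e^{iθ}`. -/
lemma isPhaseShift_iff_isSMatrixElement (j : ℝ) (ν : WithTop ℝ) (m : ℤ) (k δ : ℝ) :
    IsPhaseShift j ν m k δ ↔
      IsSMatrixElement j ν m k (Complex.exp (2 * Complex.I * (δ : ℂ))) := by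
  have hcos (θ : ℝ) : ((Real.cos (θ + δ) : ℝ) : ℂ) = Complex.exp (-(Complex.I * δ)) / 2 *
      (Complex.exp (-(Complex.I * (θ : ℂ))) +
        Complex.exp (2 * Complex.I * (δ : ℂ)) * Complex.exp (Complex.I * (θ : ℂ))) := by
    have e : Complex.exp (-(Complex.I * δ)) / 2 * (Complex.exp (-(Complex.I * (θ : ℂ))) +
        Complex.exp (2 * Complex.I * (δ : ℂ)) * Complex.exp (Complex.I * (θ : ℂ))) =
        (Complex.exp (-(Complex.I * δ)) * Complex.exp (-(Complex.I * (θ : ℂ))) +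
        Complex.exp (-(Complex.I * δ)) * Complex.exp (2 * Complex.I * (δ : ℂ)) *
          Complex.exp (Complex.I * (θ : ℂ))) / 2 := by ring
    rw [e, ← Complex.exp_add, ← Complex.exp_add, ← Complex.exp_add, Complex.ofReal_cos,
      Complex.cos, add_comm (Complex.exp _)]
    push_cast
    congr 3 <;> ring
  have hne : Complex.exp (-(Complex.I * δ)) / 2 ≠ 0 :=
    div_ne_zero (Complex.exp_ne_zero _) two_ne_zero
  constructor
  · rintro ⟨ψ, hψ, C, hC, h⟩
    refine ⟨ψ, hψ, C * (Complex.exp (-(Complex.I * δ)) / 2), mul_ne_zero hC hne,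
      h.congr fun r => ?_⟩
    rw [hcos]
    ring
  · rintro ⟨ψ, hψ, C, hC, h⟩
    refine ⟨ψ, hψ, C / (Complex.exp (-(Complex.I * δ)) / 2), div_ne_zero hC hne,
      h.congr fun r => ?_⟩
    rw [hcos, ← mul_assoc, div_mul_cancel₀ _ hne]

lemma exp_two_mul_I_eq_iff (δ δ' : ℝ) :
    Complex.exp (2 * Complex.I * (δ : ℂ)) = Complex.exp (2 * Complex.I * (δ' : ℂ)) ↔
      ∃ n : ℤ, δ = δ' + n * Real.pi := by
  rw [Complex.exp_eq_exp_iff_exists_int]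
  refine exists_congr fun n => ?_
  rw [← Complex.ofReal_inj]
  push_cast
  have h : (2 : ℂ) * Complex.I ≠ 0 := mul_ne_zero two_ne_zero Complex.I_ne_zero
  rw [← mul_right_inj' h (b := (δ : ℂ))]
  ring_nf

lemma exp_two_mul_I_arctan (μ : ℝ) : Complex.exp (2 * Complex.I * (Real.arctan μ : ℂ)) =
    (1 + Complex.I * μ) / (1 - Complex.I * μ) := by
  have h1 : Complex.exp (2 * Complex.I * (Real.arctan μ : ℂ)) =
      Complex.exp ((Real.arctan μ : ℂ) * Complex.I) ^ 2 := by
    rw [← Complex.exp_nat_mul]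
    congr 1
    push_cast
    ring
  have hpos : 0 < 1 + μ ^ 2 := by positivity
  have hs : ((√(1 + μ ^ 2) : ℝ) : ℂ) ^ 2 = 1 + (μ : ℂ) ^ 2 := by
    rw [← Complex.ofReal_pow, Real.sq_sqrt hpos.le]
    push_cast
    rfl
  have hs0 : ((√(1 + μ ^ 2) : ℝ) : ℂ) ≠ 0 := Complex.ofReal_ne_zero.2 (Real.sqrt_pos.2 hpos).ne'
  have hd : 1 - Complex.I * μ ≠ 0 := by
    intro h
    simpa using congrArg Complex.re h
  rw [h1, Complex.exp_mul_I, ← Complex.ofReal_cos, ← Complex.ofReal_sin, Real.cos_arctan,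
    Real.sin_arctan]
  push_cast
  rw [div_add' _ _ _ hs0, div_pow, hs, div_eq_div_iff _ hd]
  · field_simp
    linear_combination (-(1 + Complex.I * μ) * μ ^ 2) * Complex.I_sq
  · rw [← hs]
    exact pow_ne_zero 2 hs0

lemma mu_top (j k : ℝ) : mu j k ⊤ = 0 := rfl

lemma mu_coe (j k v : ℝ) : mu j k v =
    k ^ (2 * |j|) * Real.Gamma (1 - |j|) * Real.sin (|j| * Real.pi) / muDenom j k v := rfl

lemma exp_phaseShift (j : ℝ) (ν : WithTop ℝ) (m : ℤ) (k : ℝ) :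
    Complex.exp (2 * Complex.I * (phaseShift j ν m k : ℂ)) =
      Complex.exp (2 * Complex.I * (phaseShiftAB j m : ℂ)) *
        ((1 + Complex.I * (mu j k ν : ℂ)) / (1 - Complex.I * (mu j k ν : ℂ))) := by
  rw [← exp_two_mul_I_arctan, ← Complex.exp_add, phaseShift]
  push_cast
  ring_nf

lemma muDenom_eq {j k : ℝ} (hj0 : 0 < |j|) (v : ℝ) :
    muDenom j k v = 4 ^ |j| * Real.Gamma (1 + |j|) *
      (v + connectionCoeff |j| * k ^ (2 * |j|) * Real.cos (|j| * Real.pi)) := by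
  have g := Real.Gamma_pos_of_pos (by linarith : 0 < 1 + |j|)
  rw [muDenom, connectionCoeff]
  field_simp

lemma mu_coe_eq {j k : ℝ} (hj0 : 0 < |j|) (v : ℝ) :
    mu j k v = connectionCoeff |j| * k ^ (2 * |j|) * Real.sin (|j| * Real.pi) /
      (v + connectionCoeff |j| * k ^ (2 * |j|) * Real.cos (|j| * Real.pi)) := by
  have g := Real.Gamma_pos_of_pos (by linarith : 0 < 1 + |j|)
  have e : k ^ (2 * |j|) * Real.Gamma (1 - |j|) = 4 ^ |j| * Real.Gamma (1 + |j|) *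
      (connectionCoeff |j| * k ^ (2 * |j|)) := by
    rw [connectionCoeff]
    field_simp
  rw [mu_coe, muDenom_eq hj0, e, mul_assoc (4 ^ |j| * Real.Gamma (1 + |j|)), mul_div_mul_left]
  positivity

lemma jostFactor_div_eq {j k : ℝ} (hj0 : 0 < |j|) {ν : WithTop ℝ}
    (hν : ∀ v : ℝ, ν = (v : WithTop ℝ) → muDenom j k v ≠ 0) :
    jostFactor |j| k ν 1 / jostFactor |j| k ν (-1) =
      (1 + Complex.I * (mu j k ν : ℂ)) / (1 - Complex.I * (mu j k ν : ℂ)) := by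
  rw [jostFactor, jostFactor, exp_eq_cos_add_sin, exp_neg_eq_cos_sub_sin]
  induction ν with
  | top => simp [mu_top]
  | coe v =>
    have h := hν v rfl
    rw [muDenom_eq hj0] at h
    have hd := right_ne_zero_of_mul h
    rw [mu_coe_eq hj0]
    set T := connectionCoeff |j| * k ^ (2 * |j|)
    set d := v + T * Real.cos (|j| * Real.pi) with hd'
    have hdc : (d : ℂ) ≠ 0 := Complex.ofReal_ne_zero.2 hd
    rw [← mul_div_mul_left (1 + _) (1 - _) hdc]
    have hdd : (d : ℂ) = v + T * Real.cos (|j| * Real.pi) := by rw [hd']; push_cast; rfl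
    have hcancel (x : ℂ) : (d : ℂ) * (Complex.I * (x / d)) = Complex.I * x := by
      rw [mul_left_comm, mul_div_cancel₀ _ hdc]
    rw [mul_add (d : ℂ), mul_sub (d : ℂ), mul_one, Complex.ofReal_div, hcancel, hdd]
    simp only [regularWeight_coe, singularWeight_coe]
    push_cast
    congr 1 <;> ring

/-! ### Bessel functions as Frobenius solutions -/

lemma besselJ_mul_eq {p k r : ℝ} (hp : -1 < p) (hk : 0 < k) (hr : 0 < r) :
    besselJ p (k * r) = (k / 2) ^ p / Real.Gamma (1 + p) * frobenius p (-k ^ 2) r := by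
  have g := Real.Gamma_pos_of_pos (by linarith : 0 < 1 + p)
  rw [besselJ_eq p (mul_pos hk hr), frobenius, show k * r / 2 = k / 2 * r by ring,
    Real.mul_rpow (by positivity) hr.le, show -((k * r) ^ 2 / 4) = -k ^ 2 * r ^ 2 / 4 by ring]
  field_simp

/-- `J_p(kr) - μ_ν Y_p(kr)` is a nonzero multiple of `boundarySolution`. -/
lemma exists_bessel_eq {j k : ℝ} (hj0 : 0 < |j|) (hj1 : |j| < 1) (hk : 0 < k) {ν : WithTop ℝ}
    (hν : ∀ v : ℝ, ν = (v : WithTop ℝ) → muDenom j k v ≠ 0) :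
    ∃ t : ℝ, t ≠ 0 ∧ ∀ r : ℝ, 0 < r →
      besselJ |j| (k * r) - mu j k ν * besselY |j| (k * r) =
        t * boundarySolution |j| ν (-k ^ 2) r := by
  have g1 := Real.Gamma_pos_of_pos (by linarith : 0 < 1 + |j|)
  have g2 := Real.Gamma_pos_of_pos (by linarith : 0 < 1 - |j|)
  have hk2 : 0 < (k / 2) ^ |j| := by positivity
  induction ν with
  | top =>
    refine ⟨(k / 2) ^ |j| / Real.Gamma (1 + |j|), by positivity, fun r hr => ?_⟩
    rw [besselJ_mul_eq (by linarith) hk hr, mu_top, boundarySolution]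
    simp
  | coe v =>
    have h := hν v rfl
    rw [muDenom_eq hj0] at h
    have hd := right_ne_zero_of_mul h
    have hs := sin_mul_pi_pos hj0 hj1
    refine ⟨(k / 2) ^ |j| / Real.Gamma (1 + |j|) /
      (v + connectionCoeff |j| * k ^ (2 * |j|) * Real.cos (|j| * Real.pi)),
      div_ne_zero (by positivity) hd, fun r hr => ?_⟩
    have e4 : (4 : ℝ) ^ |j| = 2 ^ |j| * 2 ^ |j| := by
      rw [← Real.mul_rpow (by norm_num) (by norm_num)]; norm_num
    have hT : connectionCoeff |j| * k ^ (2 * |j|) * ((k / 2) ^ (-|j|) / Real.Gamma (1 - |j|)) =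
        (k / 2) ^ |j| / Real.Gamma (1 + |j|) := by
      have h2 : (2 : ℝ) ^ |j| ≠ 0 := by positivity
      have h3 : k ^ |j| ≠ 0 := by positivity
      rw [connectionCoeff, e4, two_mul, Real.rpow_add hk, Real.rpow_neg (by positivity),
        Real.div_rpow hk.le zero_le_two]
      field_simp
    rw [besselY, besselJ_mul_eq (by linarith) hk hr, besselJ_mul_eq (by linarith) hk hr,
      mu_coe_eq hj0, boundarySolution, regularWeight_coe, singularWeight_coe,
      show (1 : ℝ) + -|j| = 1 - |j| by ring]
    generalize connectionCoeff |j| * k ^ (2 * |j|) = T at *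
    rw [← hT]
    generalize (k / 2) ^ (-|j|) / Real.Gamma (1 - |j|) = X at *
    generalize Real.cos (|j| * Real.pi) = c at *
    generalize Real.sin (|j| * Real.pi) = s at *
    field_simp
    ring

/-! ### Bound states -/

lemma radialMeasure_absolutelyContinuous :
    radialMeasure ≪ volume.restrict (Set.Ioi (0 : ℝ)) :=
  withDensity_absolutelyContinuous _ _

lemma memLp_radialMeasure_iff {f : ℝ → ℂ} (hf : ContinuousOn f (Set.Ioi 0)) :
    MemLp f 2 radialMeasure ↔ IntegrableOn (fun r : ℝ => r * ‖f r‖ ^ 2) (Set.Ioi 0) := by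
  have hm : AEStronglyMeasurable f radialMeasure :=
    (hf.aestronglyMeasurable measurableSet_Ioi).mono_ac radialMeasure_absolutelyContinuous
  rw [memLp_two_iff_integrable_sq_norm hm, radialMeasure,
    integrable_withDensity_iff_integrable_smul' (by fun_prop)
      (Eventually.of_forall fun _ => ENNReal.ofReal_lt_top)]
  refine integrable_congr ?_
  filter_upwards [ae_restrict_mem measurableSet_Ioi] with r hr
  rw [ENNReal.toReal_ofReal (le_of_lt hr), smul_eq_mul]

lemma continuousOn_boundarySolution {p : ℝ} (hp0 : 0 < p) (hp1 : p < 1) (ν : WithTop ℝ)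
    (lam : ℝ) : ContinuousOn (fun r => (boundarySolution p ν lam r : ℂ)) (Set.Ioi 0) := by
  obtain ⟨u', hu'⟩ := isRadialSolution_boundarySolution hp0 hp1 ν lam
  exact fun r hr => (hu' r hr).1.continuousAt.continuousWithinAt

lemma isBoundStateEnergy_iff {j : ℝ} (hj0 : 0 < |j|) (hj1 : |j| < 1) (ν : WithTop ℝ) (M E : ℝ) :
    IsBoundStateEnergy j ν M E ↔
      MemLp (fun r => (boundarySolution |j| ν (-(2 * M * E)) r : ℂ)) 2 radialMeasure := by
  have hae : ∀ᵐ r ∂radialMeasure, (0 : ℝ) < r :=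
    radialMeasure_absolutelyContinuous.ae_le (ae_restrict_mem measurableSet_Ioi)
  constructor
  · rintro ⟨ψ, ⟨hreg, hL, _, hbc⟩, heq, hne⟩
    obtain ⟨t, ht, h⟩ := (solution_iff hj0 hj1 ν (2 * M * E) ψ).1 ⟨hreg, hbc, heq, hne⟩
    refine (memLp_congr_ae ?_).1 (hL.const_mul t⁻¹)
    filter_upwards [hae] with r hr
    rw [h r hr, inv_mul_cancel_left₀ ht]
  · intro hL
    obtain ⟨hreg, hbc, heq, hne⟩ := (solution_iff hj0 hj1 ν (2 * M * E)
      (fun r => (boundarySolution |j| ν (-(2 * M * E)) r : ℂ))).2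
      ⟨1, one_ne_zero, fun r _ => (one_mul _).symm⟩
    refine ⟨_, ⟨hreg, hL, ?_, hbc⟩, heq, hne⟩
    exact (memLp_congr_ae (radialMeasure_absolutelyContinuous.ae_le heq)).2 (hL.const_mul _)

lemma not_integrableOn_of_eventually_le {g : ℝ → ℝ} {ε : ℝ} (hε : 0 < ε)
    (h : ∀ᶠ r in atTop, ε ≤ g r) : ¬ IntegrableOn g (Set.Ioi 0) := by
  intro hg
  obtain ⟨R, hR⟩ := eventually_atTop.1 (h.and (eventually_gt_atTop 0))
  have h1 : IntegrableOn g (Set.Ioi R) :=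
    hg.mono_set (Set.Ioi_subset_Ioi (hR R le_rfl).2.le)
  have h2 : IntegrableOn (fun _ : ℝ => ε) (Set.Ioi R) := by
    refine Integrable.mono' h1 aestronglyMeasurable_const ?_
    filter_upwards [ae_restrict_mem measurableSet_Ioi] with r hr
    rw [Real.norm_of_nonneg hε.le]
    exact (hR r (le_of_lt hr)).1
  rw [integrableOn_const_iff] at h2
  rcases h2 with h2 | h2
  · exact hε.ne' (by simpa using h2)
  · simp at h2

/-- A solution with positive eigenvalue `k²` is not square integrable: a quarter period apart, the
squared moduli of its asymptotic wave add up to a constant. -/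
lemma not_memLp_of_neg {j : ℝ} (hj0 : 0 < |j|) (hj1 : |j| < 1) (ν : WithTop ℝ) {k : ℝ}
    (hk : 0 < k) : ¬ MemLp (fun r => (boundarySolution |j| ν (-k ^ 2) r : ℂ)) 2 radialMeasure := by
  rw [memLp_radialMeasure_iff (continuousOn_boundarySolution hj0 hj1 ν _)]
  intro hint
  obtain ⟨C, hC, h⟩ := exists_tendsto_boundarySolution hj0 hj1 ν 0 hk
  set S := Complex.exp (2 * Complex.I * (phaseShiftAB j 0 : ℂ)) *
    (jostFactor |j| k ν 1 / jostFactor |j| k ν (-1))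
  set s := Real.pi / (2 * k) with hs
  have hs0 : 0 < s := div_pos Real.pi_pos (by linarith)
  set u : ℝ → ℂ := fun r => ((√r : ℝ) : ℂ) * boundarySolution |j| ν (-k ^ 2) r with hu
  set w : ℝ → ℂ := fun r => C * (Complex.exp (-(Complex.I * (freePhase 0 k r : ℂ))) +
        S * Complex.exp (Complex.I * (freePhase 0 k r : ℂ))) with hw
  have hsq : ∀ r : ℝ, 0 < r →
      r * ‖(boundarySolution |j| ν (-k ^ 2) r : ℂ)‖ ^ 2 = ‖u r‖ ^ 2 := by
    intro r hr
    rw [hu]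
    simp only
    rw [norm_mul, mul_pow, Complex.norm_of_nonneg (Real.sqrt_nonneg r), Real.sq_sqrt hr.le]
  have hint1 : IntegrableOn (fun r => ‖u r‖ ^ 2) (Set.Ioi 0) :=
    hint.congr_fun hsq measurableSet_Ioi
  have hint2 : IntegrableOn (fun r => ‖u (r + s)‖ ^ 2) (Set.Ioi 0) := by
    have h1 := ((measurePreserving_add_right volume s).integrableOn_comp_preimage
      (measurableEmbedding_addRight s)).2 (hint1.mono_set (Set.Ioi_subset_Ioi hs0.le))
    rwa [Set.preimage_add_const_Ioi, sub_self] at h1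
  refine not_integrableOn_of_eventually_le (ε := ‖C‖ ^ 2 / 2) (by positivity) ?_ (hint1.add hint2)
  have hsum : ∀ r : ℝ, 2 * ‖C‖ ^ 2 ≤ ‖w r‖ ^ 2 + ‖w (r + s)‖ ^ 2 := by
    intro r
    have e : freePhase 0 k (r + s) = freePhase 0 k r + Real.pi / 2 := by
      rw [freePhase, freePhase, hs]
      field_simp
      ring
    have e1 : Complex.exp (Complex.I * (freePhase 0 k (r + s) : ℂ)) =
        Complex.I * Complex.exp (Complex.I * (freePhase 0 k r : ℂ)) := by
      rw [e]
      push_cast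
      rw [mul_add, Complex.exp_add, mul_comm Complex.I (Real.pi / 2 : ℂ),
        Complex.exp_pi_div_two_mul_I, mul_comm]
    have e2 : Complex.exp (-(Complex.I * (freePhase 0 k (r + s) : ℂ))) =
        -Complex.I * Complex.exp (-(Complex.I * (freePhase 0 k r : ℂ))) := by
      rw [Complex.exp_neg, Complex.exp_neg, e1, mul_inv, Complex.inv_I]
    have n1 : ‖Complex.exp (-(Complex.I * (freePhase 0 k r : ℂ)))‖ = 1 := by
      rw [Complex.exp_neg, norm_inv, norm_exp_I_mul_ofReal, inv_one]
    simp only [hw]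
    rw [e1, e2]
    set V := Complex.exp (-(Complex.I * (freePhase 0 k r : ℂ)))
    set U := S * Complex.exp (Complex.I * (freePhase 0 k r : ℂ)) with hU
    have e3 : C * (-Complex.I * V + S * (Complex.I *
        Complex.exp (Complex.I * (freePhase 0 k r : ℂ)))) = -Complex.I * (C * (V - U)) := by
      rw [hU]; ring
    have e4 : ‖-Complex.I * (C * (V - U))‖ = ‖C‖ * ‖V - U‖ := by simp
    rw [e3, e4, norm_mul, mul_pow, mul_pow]
    have par := parallelogram_law_with_norm ℝ V U
    rw [n1] at par
    nlinarith [norm_nonneg U, sq_nonneg ‖C‖, mul_nonneg (sq_nonneg ‖C‖) (sq_nonneg ‖U‖)]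
  have hclose : ∀ᶠ r in atTop, ‖u r - w r‖ ^ 2 < ‖C‖ ^ 2 / 4 := by
    have h2 := (h.norm.pow 2)
    rw [norm_zero, zero_pow two_ne_zero] at h2
    exact h2.eventually_lt_const (by positivity)
  have hshift : Tendsto (fun r : ℝ => r + s) atTop atTop :=
    tendsto_atTop_add_const_right _ _ tendsto_id
  filter_upwards [hclose, hshift.eventually hclose] with r h1 h2
  have tri : ∀ x : ℝ, ‖w x‖ ^ 2 ≤ 2 * ‖u x - w x‖ ^ 2 + 2 * ‖u x‖ ^ 2 := by
    intro x
    have : ‖w x‖ ≤ ‖u x‖ + ‖u x - w x‖ := by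
      have := norm_sub_le (u x) (u x - w x)
      rwa [sub_sub_cancel] at this
    nlinarith [norm_nonneg (w x), sq_nonneg (‖u x‖ - ‖u x - w x‖)]
  have := hsum r
  have t1 := tri r
  have t2 := tri (r + s)
  simp only [Pi.add_apply]
  linarith

lemma rpow_le_frobenius {p lam : ℝ} (hp0 : 0 < p) (hlam : 0 ≤ lam) {r : ℝ} (hr : 0 < r) :
    r ^ p ≤ frobenius p lam r := by
  have g := Real.Gamma_pos_of_pos (by linarith : 0 < 1 + p)
  have h : 1 / Real.Gamma (1 + p) ≤ besselEntire p (lam * r ^ 2 / 4) := by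
    have := (summable_besselEntire p (lam * r ^ 2 / 4)).le_tsum 0 fun n _ => by
      have : 0 < Real.Gamma ((n : ℝ) + p + 1) := Real.Gamma_pos_of_pos (by positivity)
      positivity
    simpa [besselEntire, add_comm] using this
  rw [frobenius]
  calc r ^ p = Real.Gamma (1 + p) * r ^ p * (1 / Real.Gamma (1 + p)) := by field_simp
    _ ≤ _ := by gcongr

/-- For `lam ≥ 0` any admixture of the growing solution to a vanishing one destroys square
integrability. -/
lemma not_memLp_of_growing {p lam : ℝ} (hp0 : 0 < p) (hlam : 0 ≤ lam)
    {f y : ℝ → ℂ} (hf : ContinuousOn f (Set.Ioi 0)) {a : ℂ} (ha : a ≠ 0)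
    (hfy : ∀ r : ℝ, 0 < r → f r = y r + a * frobenius p lam r) (hy : Tendsto y atTop (𝓝 0)) :
    ¬ MemLp f 2 radialMeasure := by
  rw [memLp_radialMeasure_iff hf]
  have ha' : 0 < ‖a‖ := norm_pos_iff.2 ha
  refine not_integrableOn_of_eventually_le (ε := (‖a‖ / 2) ^ 2) (by positivity) ?_
  have h2 := hy.norm
  rw [norm_zero] at h2
  filter_upwards [h2.eventually_lt_const (by positivity : 0 < ‖a‖ / 2), eventually_ge_atTop 1]
    with r hr1 hr
  have hr0 : 0 < r := by linarith
  have hΦ : 1 ≤ frobenius p lam r :=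
    (Real.one_le_rpow hr hp0.le).trans (rpow_le_frobenius hp0 hlam hr0)
  have h3 : ‖a‖ ≤ ‖a * (frobenius p lam r : ℂ)‖ := by
    rw [norm_mul, Complex.norm_of_nonneg (by linarith)]
    exact le_mul_of_one_le_right ha'.le hΦ
  have h4 : ‖a‖ / 2 ≤ ‖f r‖ := by
    have := norm_sub_le (f r) (y r)
    rw [hfy r hr0, add_sub_cancel_left, ← hfy r hr0] at this
    linarith
  calc (‖a‖ / 2) ^ 2 ≤ 1 * ‖f r‖ ^ 2 := by rw [one_mul]; gcongr
    _ ≤ r * ‖f r‖ ^ 2 := by gcongr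

lemma memLp_of_hasDecay {p lam : ℝ} (hp0 : 0 < p) (hp1 : p < 1) (v : ℝ) {κ : ℝ} (hκ : 0 < κ)
    {A : ℂ} (h : HasDecay κ (fun r => (boundarySolution p v lam r : ℂ)) A) :
    MemLp (fun r => (boundarySolution p v lam r : ℂ)) 2 radialMeasure := by
  have hc := continuousOn_boundarySolution hp0 hp1 v lam
  rw [memLp_radialMeasure_iff hc]
  have hc2 : ContinuousOn (fun r : ℝ => r * ‖(boundarySolution p v lam r : ℂ)‖ ^ 2)
      (Set.Ioi 0) := continuousOn_id.mul (hc.norm.pow 2)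
  rw [← Set.Ioc_union_Ioi_eq_Ioi zero_le_one, integrableOn_union]
  constructor
  · -- near the origin the integrand is `O(r^{1-2p})`
    set B : ℝ → ℝ := fun r => v * r ^ (2 * p) * (Real.Gamma (1 + p) *
      besselEntire p (lam * r ^ 2 / 4)) +
      Real.Gamma (1 + -p) * besselEntire (-p) (lam * r ^ 2 / 4) with hB
    have hBc : Continuous B := by
      have h1 := continuous_besselEntire p
      have h2 := continuous_besselEntire (-p)
      have h3 : Continuous fun r : ℝ => r ^ (2 * p) :=
        Real.continuous_rpow_const (by linarith)
      fun_prop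
    obtain ⟨K, hK⟩ := isCompact_Icc.exists_bound_of_continuousOn
      (hBc.continuousOn (s := Set.Icc (0 : ℝ) 1))
    have hint : IntegrableOn (fun r : ℝ => K ^ 2 * r ^ (1 - 2 * p)) (Set.Ioc 0 1) := by
      refine Integrable.const_mul ?_ _
      rw [← IntegrableOn, ← intervalIntegrable_iff_integrableOn_Ioc_of_le zero_le_one]
      exact intervalIntegral.intervalIntegrable_rpow' (by linarith)
    refine Integrable.mono' hint ((hc2.mono Set.Ioc_subset_Ioi_self).aestronglyMeasurable
      measurableSet_Ioc) ?_
    filter_upwards [ae_restrict_mem measurableSet_Ioc] with r hr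
    have hr0 : 0 < r := hr.1
    have e : boundarySolution p v lam r = r ^ (-p) * B r := by
      have : r ^ (-p) * r ^ (2 * p) = r ^ p := by
        rw [← Real.rpow_add hr0]; congr 1; ring
      rw [boundarySolution, regularWeight_coe, singularWeight_coe, frobenius, frobenius, hB]
      simp only
      rw [← this]
      ring
    have e2 : r ^ (1 - 2 * p) = r * (r ^ (-p)) ^ 2 := by
      rw [sub_eq_add_neg, Real.rpow_add hr0, Real.rpow_one, two_mul, neg_add,
        Real.rpow_add hr0, pow_two]
    have hBK : ‖B r‖ ≤ K := hK r ⟨hr0.le, hr.2⟩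
    rw [Real.norm_of_nonneg (by positivity), e, e2, Complex.norm_real, norm_mul,
      Real.norm_of_nonneg (by positivity : 0 ≤ r ^ (-p)), mul_pow]
    have : ‖B r‖ ^ 2 ≤ K ^ 2 := by gcongr
    calc r * ((r ^ (-p)) ^ 2 * ‖B r‖ ^ 2) ≤ r * ((r ^ (-p)) ^ 2 * K ^ 2) := by gcongr
      _ = _ := by ring
  · refine integrable_of_isBigO_exp_neg (b := 2 * κ) (by linarith)
      (hc2.mono fun r hr => Set.mem_Ioi.2 (lt_of_lt_of_le one_pos (Set.mem_Ici.1 hr))) ?_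
    have hO := (h.norm.pow 2).isBigO_one ℝ
    have hO2 := hO.mul (Asymptotics.isBigO_refl (fun r : ℝ => Real.exp (-(2 * κ) * r)) atTop)
    refine hO2.congr' ?_ (by simp)
    filter_upwards [eventually_gt_atTop 0] with r hr
    have he : Real.exp (κ * r) ^ 2 * Real.exp (-(2 * κ) * r) = 1 := by
      rw [← Real.exp_nat_mul, ← Real.exp_add]
      push_cast
      ring_nf
      simp
    rw [norm_mul, norm_mul, Complex.norm_of_nonneg (Real.sqrt_nonneg r), ← Complex.ofReal_mul,
      ← Complex.ofReal_exp, Complex.norm_of_nonneg (Real.exp_pos _).le, mul_pow, mul_pow,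
      Real.sq_sqrt hr.le]
    linear_combination r * ‖(boundarySolution p v lam r : ℂ)‖ ^ 2 * he

lemma HasDecay.tendsto_zero {κ : ℝ} (hκ : 0 ≤ κ) {u : ℝ → ℂ} {A : ℂ} (h : HasDecay κ u A) :
    Tendsto u atTop (𝓝 0) := by
  have h1 : Tendsto (fun x : ℝ => √x) atTop atTop := Real.tendsto_sqrt_atTop
  have h2 := h.norm.mul h1.inv_tendsto_atTop
  rw [mul_zero] at h2
  refine squeeze_zero_norm' ?_ h2
  filter_upwards [eventually_gt_atTop 0] with x hx
  have hs : 0 < √x := Real.sqrt_pos.2 hx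
  rw [norm_mul, norm_mul, Complex.norm_of_nonneg hs.le, ← Complex.ofReal_mul,
    ← Complex.ofReal_exp, Complex.norm_of_nonneg (Real.exp_pos _).le, Pi.inv_apply]
  have : 1 ≤ Real.exp (κ * x) := Real.one_le_exp (mul_nonneg hκ hx.le)
  have e : √x * Real.exp (κ * x) * ‖u x‖ * (√x)⁻¹ = Real.exp (κ * x) * ‖u x‖ := by
    field_simp
  rw [e]
  exact le_mul_of_one_le_left (norm_nonneg _) this

lemma frobenius_zero {σ : ℝ} (hσ : -1 < σ) (r : ℝ) : frobenius σ 0 r = r ^ σ := by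
  have g := Real.Gamma_pos_of_pos (by linarith : 0 < 1 + σ)
  rw [frobenius, zero_mul, zero_div, besselEntire_zero]
  field_simp

/-- For `ν = v < 0` there is one square integrable solution with the boundary condition. -/
theorem memLp_boundarySolution_iff {j : ℝ} (hj0 : 0 < |j|) (hj1 : |j| < 1) {v : ℝ} (hv : v < 0)
    (lam : ℝ) : MemLp (fun r => (boundarySolution |j| v lam r : ℂ)) 2 radialMeasure ↔
      0 < lam ∧ connectionCoeff |j| * lam ^ |j| = -v := by
  set p := |j| with hp
  have hcont := continuousOn_boundarySolution hj0 hj1 v lam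
  rcases lt_trichotomy lam 0 with hlam | rfl | hlam
  · have h : lam = -(√(-lam)) ^ 2 := by rw [Real.sq_sqrt (by linarith)]; ring
    refine iff_of_false ?_ fun h => absurd h.1 hlam.not_gt
    rw [h]
    exact not_memLp_of_neg hj0 hj1 v (Real.sqrt_pos.2 (by linarith))
  · refine iff_of_false ?_ fun h => lt_irrefl _ h.1
    refine not_memLp_of_growing hj0 le_rfl hcont (a := v) (Complex.ofReal_ne_zero.2 hv.ne)
      (y := fun r => ((r ^ (-p) : ℝ) : ℂ)) (fun r hr => ?_) ?_
    · rw [boundarySolution, regularWeight_coe, singularWeight_coe,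
        frobenius_zero (by linarith : -1 < -p)]
      push_cast
      ring
    · exact_mod_cast (Complex.continuous_ofReal.tendsto _).comp (tendsto_rpow_neg_atTop hj0)
  · have hκ : 0 < √lam := Real.sqrt_pos.2 hlam
    have hd := hasDecay_frobenius (lam := lam) hj0 hj1 (c := (√lam : ℝ)) (by simp)
      (Complex.ofReal_ne_zero.2 hκ.ne') (by rw [← Complex.ofReal_pow, Real.sq_sqrt hlam.le])
    have hpow : ((√lam : ℝ) : ℂ) ^ ((2 * p : ℝ) : ℂ) = ((lam ^ p : ℝ) : ℂ) := by
      rw [← Complex.ofReal_cpow hκ.le, Real.sqrt_eq_rpow, ← Real.rpow_mul hlam.le]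
      congr 2
      ring
    rw [hpow] at hd
    constructor
    · intro hL
      refine ⟨hlam, ?_⟩
      by_contra hne
      refine not_memLp_of_growing hj0 hlam.le hcont
        (a := ((v + connectionCoeff p * lam ^ p : ℝ) : ℂ))
        (Complex.ofReal_ne_zero.2 fun h => hne (by linarith)) (fun r hr => ?_)
        (hd.tendsto_zero hκ.le) hL
      rw [boundarySolution, regularWeight_coe, singularWeight_coe]
      push_cast
      ring
    · rintro ⟨_, hv'⟩
      refine memLp_of_hasDecay hj0 hj1 v hκ (hd.congr fun r hr => ?_)
      rw [boundarySolution, regularWeight_coe, singularWeight_coe,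
        show v = -(connectionCoeff p * lam ^ p) by linarith]
      push_cast
      ring

lemma eq_boundEnergy_iff {j M v : ℝ} (hj0 : 0 < |j|) (hj1 : |j| < 1) (hM : 0 < M) (hv : v < 0)
    (E : ℝ) : (0 < -(2 * M * E) ∧ connectionCoeff |j| * (-(2 * M * E)) ^ |j| = -v) ↔
      E = boundEnergy j M v := by
  have g1 := Real.Gamma_pos_of_pos (by linarith : 0 < 1 + |j|)
  have g2 := Real.Gamma_pos_of_pos (by linarith : 0 < 1 - |j|)
  set X := -v * Real.Gamma (1 + |j|) / Real.Gamma (1 - |j|) with hX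
  have hX0 : 0 < X := div_pos (mul_pos (by linarith) g1) g2
  have hinv : |j| * (1 / |j|) = 1 := mul_one_div_cancel hj0.ne'
  have key : ∀ lam : ℝ, 0 < lam → (connectionCoeff |j| * lam ^ |j| = -v ↔ (lam / 4) ^ |j| = X) := by
    intro lam hlam
    rw [Real.div_rpow hlam.le (by norm_num), connectionCoeff, hX]
    field_simp
  rw [boundEnergy, ← hX]
  constructor
  · rintro ⟨h0, h⟩
    have h1 := (key _ h0).1 h
    have h2 : -(2 * M * E) / 4 = X ^ (1 / |j|) := by
      rw [← h1, ← Real.rpow_mul (by positivity), hinv, Real.rpow_one]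
    rw [← h2]
    field_simp
    ring
  · intro h
    have h2 : -(2 * M * E) = 4 * X ^ (1 / |j|) := by
      rw [h]
      field_simp
      ring
    have h3 : 0 < X ^ (1 / |j|) := Real.rpow_pos_of_pos hX0 _
    have h4 : 0 < -(2 * M * E) := by rw [h2]; positivity
    refine ⟨h4, (key _ h4).2 ?_⟩
    rw [h2, mul_div_cancel_left₀ _ (by norm_num : (4 : ℝ) ≠ 0), ← Real.rpow_mul hX0.le,
      mul_comm, hinv, Real.rpow_one]

/-- With `κ_b = i √lam` one has `(κ_b/k)^{2p} = e^{iπp} lam^p / k^{2p}`. -/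
lemma boundMomentum_cpow {M E k : ℝ} (p : ℝ) (hE : 0 < -(2 * M * E)) (hk : 0 < k) :
    (boundMomentum M E / (k : ℂ)) ^ ((2 * p : ℝ) : ℂ) =
      Complex.exp (1 * (Complex.I * Real.pi * p)) *
        (((-(2 * M * E)) ^ p / k ^ (2 * p) : ℝ) : ℂ) := by
  set lam := -(2 * M * E) with hlam
  have hκ : 0 < √lam := Real.sqrt_pos.2 hE
  have h1 : boundMomentum M E = (√lam : ℝ) * Complex.I := by
    have e : (2 * M * E : ℝ) = -lam := by rw [hlam]; ring
    rw [boundMomentum, e, Complex.ofReal_neg, neg_eq_neg_one_mul, mul_comm,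
      ofReal_mul_cpow hE (by norm_num), Real.sqrt_eq_rpow, Complex.ofReal_cpow hE.le]
    push_cast
    congr 1
    rw [Complex.cpow_def_of_ne_zero (by norm_num), Complex.log_neg_one,
      show Real.pi * Complex.I * (1 / 2) = Real.pi / 2 * Complex.I by ring,
      Complex.exp_pi_div_two_mul_I]
  have h2 : boundMomentum M E / (k : ℂ) = ((√lam / k : ℝ) : ℂ) * Complex.I := by
    rw [h1]; push_cast; ring
  rw [h2, ofReal_mul_cpow (div_pos hκ hk) Complex.I_ne_zero, I_cpow,
    ← Complex.ofReal_cpow (div_pos hκ hk).le, Real.div_rpow hκ.le hk.le, Real.sqrt_eq_rpow,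
    ← Real.rpow_mul hE.le, show 1 / 2 * (2 * p) = p by ring, mul_comm]
  congr 2
  push_cast
  ring

/-! ### Eigenfunctions and scattering data in terms of `μ_ν` and `κ_b` -/

lemma isGeneralizedEigenfunction_iff_bessel {j k : ℝ} (hj0 : 0 < |j|) (hj1 : |j| < 1) (hk : 0 < k)
    {ν : WithTop ℝ} (hν : ∀ v : ℝ, ν = (v : WithTop ℝ) → muDenom j k v ≠ 0) (ψ : ℝ → ℂ) :
    IsGeneralizedEigenfunction j ν k ψ ↔ ∃ a : ℂ, a ≠ 0 ∧ ∀ r : ℝ, 0 < r →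
      ψ r = a * ((besselJ |j| (k * r) - mu j k ν * besselY |j| (k * r) : ℝ) : ℂ) := by
  obtain ⟨t, ht, h⟩ := exists_bessel_eq hj0 hj1 hk hν
  have htc : (t : ℂ) ≠ 0 := Complex.ofReal_ne_zero.2 ht
  rw [isGeneralizedEigenfunction_iff hj0 hj1]
  constructor
  · rintro ⟨a, ha, hψ⟩
    refine ⟨a / t, div_ne_zero ha htc, fun r hr => ?_⟩
    rw [h r hr, hψ r hr, Complex.ofReal_mul, ← mul_assoc, div_mul_cancel₀ _ htc]
  · rintro ⟨a, ha, hψ⟩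
    refine ⟨a * t, mul_ne_zero ha htc, fun r hr => ?_⟩
    rw [hψ r hr, h r hr, Complex.ofReal_mul, mul_assoc]

lemma isSMatrixElement_iff_exp_phaseShift {j k : ℝ} (hj0 : 0 < |j|) (hj1 : |j| < 1) (hk : 0 < k)
    {ν : WithTop ℝ} (hν : ∀ v : ℝ, ν = (v : WithTop ℝ) → muDenom j k v ≠ 0) (m : ℤ) (S : ℂ) :
    IsSMatrixElement j ν m k S ↔
      S = Complex.exp (2 * Complex.I * (phaseShift j ν m k : ℂ)) := by
  rw [isSMatrixElement_iff hj0 hj1 ν m hk, jostFactor_div_eq hj0 hν, exp_phaseShift]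

lemma isPhaseShift_iff {j k : ℝ} (hj0 : 0 < |j|) (hj1 : |j| < 1) (hk : 0 < k)
    {ν : WithTop ℝ} (hν : ∀ v : ℝ, ν = (v : WithTop ℝ) → muDenom j k v ≠ 0) (m : ℤ) (δ : ℝ) :
    IsPhaseShift j ν m k δ ↔ ∃ n : ℤ, δ = phaseShift j ν m k + n * Real.pi := by
  rw [isPhaseShift_iff_isSMatrixElement, isSMatrixElement_iff_exp_phaseShift hj0 hj1 hk hν,
    exp_two_mul_I_eq_iff]

/-- At a bound-state energy `v = -T τ` with `T = 4^{-p} k^{2p} Γ(1-p)/Γ(1+p)` and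
`(κ_b/k)^{2p} = e^{iπp} τ`, so both Jost factors are multiples of `T`. -/
lemma jostFactor_div_eq_boundMomentum {j k : ℝ} (hj0 : 0 < |j|) (hj1 : |j| < 1) (hk : 0 < k)
    {v M E : ℝ} (hE : 0 < -(2 * M * E))
    (hv : connectionCoeff |j| * (-(2 * M * E)) ^ |j| = -v) :
    1 - (boundMomentum M E / (k : ℂ)) ^ ((2 * |j| : ℝ) : ℂ) ≠ 0 ∧
      jostFactor |j| k v 1 / jostFactor |j| k v (-1) =
        (Complex.exp (2 * Complex.I * Real.pi * ((|j| : ℝ) : ℂ)) -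
            (boundMomentum M E / (k : ℂ)) ^ ((2 * |j| : ℝ) : ℂ)) /
          (1 - (boundMomentum M E / (k : ℂ)) ^ ((2 * |j| : ℝ) : ℂ)) := by
  have hQ : jostFactor |j| k v (-1) ≠ 0 := jostFactor_ne_zero hj0 hj1 hk v
  rw [boundMomentum_cpow |j| hE hk]
  have hK : 0 < k ^ (2 * |j|) := by positivity
  set τ : ℝ := (-(2 * M * E)) ^ |j| / k ^ (2 * |j|) with hτ
  set T : ℝ := connectionCoeff |j| * k ^ (2 * |j|) with hT
  have hvT : v = -(T * τ) := by
    rw [hT, hτ]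
    field_simp
    linarith
  set e := Complex.exp (1 * (Complex.I * Real.pi * (|j| : ℝ))) with he
  set e' := Complex.exp (-1 * (Complex.I * Real.pi * (|j| : ℝ))) with he'
  have hee : e * e' = 1 := by
    rw [he, he', ← Complex.exp_add]; ring_nf; exact Complex.exp_zero
  have he2 : Complex.exp (2 * Complex.I * Real.pi * ((|j| : ℝ) : ℂ)) = e * e := by
    rw [he, ← Complex.exp_add]; ring_nf
  have hP : jostFactor |j| k v 1 = T * (e - τ) := by
    rw [jostFactor, regularWeight_coe, singularWeight_coe, ← hT, ← he, hvT]
    push_cast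
    ring
  have hQ' : jostFactor |j| k v (-1) = T * (e' - τ) := by
    rw [jostFactor, regularWeight_coe, singularWeight_coe, ← hT, ← he', hvT]
    push_cast
    ring
  rw [hQ'] at hQ
  rw [hP, hQ', he2]
  have hTc := left_ne_zero_of_mul hQ
  have hd := right_ne_zero_of_mul hQ
  have he0 : e ≠ 0 := Complex.exp_ne_zero _
  have h1 : 1 - e * τ = e * (e' - τ) := by linear_combination -hee
  rw [h1, ← mul_sub, mul_div_mul_left _ _ he0, mul_div_mul_left _ _ hTc]
  exact ⟨mul_ne_zero he0 hd, rfl⟩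

end ConicalAB

theorem mainTheorem2 (α φ s M k : ℝ) (m : ℤ) (ν : WithTop ℝ)
    (hα0 : 0 < α) (hα1 : α ≤ 1) (hs : s = 1 ∨ s = -1) (hM : 0 < M) (hk : 0 < k)
    (j : ℝ) (hj : j = ConicalAB.effectiveJ α φ s m) (hj0 : j ≠ 0) (hj1 : |j| < 1) :
    -- eigenfunctions, phase shift and S-matrix, wherever `μ_ν` is defined
    ((∀ v : ℝ, ν = (v : WithTop ℝ) → ConicalAB.muDenom j k v ≠ 0) →
      (∀ ψ : ℝ → ℂ, ConicalAB.IsGeneralizedEigenfunction j ν k ψ ↔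
        ∃ a : ℂ, a ≠ 0 ∧ ∀ r : ℝ, 0 < r →
          ψ r = a * ((ConicalAB.besselJ |j| (k * r) -
            ConicalAB.mu j k ν * ConicalAB.besselY |j| (k * r) : ℝ) : ℂ)) ∧
      (∀ δ : ℝ, ConicalAB.IsPhaseShift j ν m k δ ↔
        ∃ n : ℤ, δ = ConicalAB.phaseShift j ν m k + n * Real.pi) ∧
      (∀ S : ℂ, ConicalAB.IsSMatrixElement j ν m k S ↔
        S = Complex.exp (2 * Complex.I * (ConicalAB.phaseShift j ν m k : ℂ))) ∧
      Complex.exp (2 * Complex.I * (ConicalAB.phaseShift j ν m k : ℂ)) =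
        Complex.exp (2 * Complex.I * (ConicalAB.phaseShiftAB j m : ℂ)) *
          ((1 + Complex.I * (ConicalAB.mu j k ν : ℂ)) /
            (1 - Complex.I * (ConicalAB.mu j k ν : ℂ)))) ∧
    -- the S-matrix in terms of the bound-state momentum, for `ν < 0`
    (∀ v : ℝ, ν = (v : WithTop ℝ) → v < 0 →
      (∀ E : ℝ, ConicalAB.IsBoundStateEnergy j ν M E ↔ E = ConicalAB.boundEnergy j M v) ∧
      (∀ E : ℝ, ConicalAB.IsBoundStateEnergy j ν M E →
        1 - (ConicalAB.boundMomentum M E / (k : ℂ)) ^ ((2 * |j| : ℝ) : ℂ) ≠ 0 ∧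
        ∀ S : ℂ, ConicalAB.IsSMatrixElement j ν m k S ↔
          S = Complex.exp (2 * Complex.I * (ConicalAB.phaseShiftAB j m : ℂ)) *
            ((Complex.exp (2 * Complex.I * Real.pi * ((|j| : ℝ) : ℂ)) -
                (ConicalAB.boundMomentum M E / (k : ℂ)) ^ ((2 * |j| : ℝ) : ℂ)) /
              (1 - (ConicalAB.boundMomentum M E / (k : ℂ)) ^ ((2 * |j| : ℝ) : ℂ))))) ∧
    -- the Aharonov–Bohm case `ν = ∞`
    (ν = ⊤ →
      (∀ ψ : ℝ → ℂ, ConicalAB.IsGeneralizedEigenfunction j ν k ψ ↔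
        ∃ a : ℂ, a ≠ 0 ∧ ∀ r : ℝ, 0 < r →
          ψ r = a * ((ConicalAB.besselJ |j| (k * r) : ℝ) : ℂ)) ∧
      (∀ S : ℂ, ConicalAB.IsSMatrixElement j ν m k S ↔ S = ConicalAB.sMatrixAB j m)) := by
  have hj0' : 0 < |j| := abs_pos.2 hj0
  refine ⟨fun hν => ⟨ConicalAB.isGeneralizedEigenfunction_iff_bessel hj0' hj1 hk hν,
    ConicalAB.isPhaseShift_iff hj0' hj1 hk hν m,
    ConicalAB.isSMatrixElement_iff_exp_phaseShift hj0' hj1 hk hν m,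
    ConicalAB.exp_phaseShift j ν m k⟩, ?_, ?_⟩
  · rintro v rfl hv
    have hbound (E : ℝ) : ConicalAB.IsBoundStateEnergy j v M E ↔ 0 < -(2 * M * E) ∧
        ConicalAB.connectionCoeff |j| * (-(2 * M * E)) ^ |j| = -v := by
      rw [ConicalAB.isBoundStateEnergy_iff hj0' hj1,
        ConicalAB.memLp_boundarySolution_iff hj0' hj1 hv]
    refine ⟨fun E => (hbound E).trans (ConicalAB.eq_boundEnergy_iff hj0' hj1 hM hv E),
      fun E hE => ?_⟩
    obtain ⟨hE0, hEv⟩ := (hbound E).1 hE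
    obtain ⟨hne, hdiv⟩ := ConicalAB.jostFactor_div_eq_boundMomentum hj0' hj1 hk hE0 hEv
    exact ⟨hne, fun S => by rw [ConicalAB.isSMatrixElement_iff hj0' hj1 _ m hk, hdiv]⟩
  · rintro rfl
    have hν : ∀ v : ℝ, (⊤ : WithTop ℝ) = v → ConicalAB.muDenom j k v ≠ 0 :=
      fun v h => absurd h (WithTop.coe_ne_top).symm
    refine ⟨fun ψ => ?_, fun S => ?_⟩
    · simpa only [ConicalAB.mu_top, zero_mul, sub_zero] using
        ConicalAB.isGeneralizedEigenfunction_iff_bessel hj0' hj1 hk hν ψ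
    · rw [ConicalAB.isSMatrixElement_iff_exp_phaseShift hj0' hj1 hk hν m, ConicalAB.phaseShift,
        ConicalAB.mu_top, Real.arctan_zero, add_zero, ConicalAB.sMatrixAB]
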